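/- Let $k$ be a field, $\theta$ a positive integer, $N_1,\dots,N_\theta$ integers greater than $1$, and $q_{ij}\in k^\times$ for $1\le i<j\le\theta$; put $q_{ji}=q_{ij}^{-1}$ for $i<j$ and $q_{ii}=1$. Let $$S=k\langle x_1,\dots,x_\theta\rangle/(x_ix_j=q_{ij}x_jx_i\ (i<j),\ x_i^{N_i}=0),$$ and let $k$ be the left $S$-module on which every $x_i$ acts as $0$. Put $\sigma_i(a)=1$ if $a$ is odd, $\sigma_i(a)=N_i-1$ if $a$ is even, and $\tau_i(a)=\sum_{j=1}^a\sigma_i(j)$. Let $K_n$ be the free left $S$-module on symbols $\Phi(a_1,\dots,a_\theta)$ with $a_i\in\mathbb Z_{\ge0}$ and $a_1+\dots+a_\theta=n$, and let $d=d_1+\dots+d_\theta:K_n\to K_{n-1}$ be the $S$-linear map with $$d_i\Phi(a_1,\dots,a_\theta)=\Big(\prod_{\ell<i}(-1)^{a_\ell}q_{\ell i}^{\sigma_i(a_i)\tau_\ell(a_\ell)}\Big)x_i^{\sigma_i(a_i)}\Phi(a_1,\dots,a_i-1,\dots,a_\theta)$$ if $a_i>0$, and $d_i\Phi(a_1,\dots,a_\theta)=0$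 if $a_i=0$. Then $(K_\bullet,d)$, with the augmentation $K_0\to k$, $\Phi(0,\dots,0)\mapsto1$, is a free resolution of $k$, and every $S$-linear map $K_n\to k$ dual to a generator is a cocycle. Let $\xi_i\in\operatorname{Ext}^2_S(k,k)$ be the class of the map $K_2\to k$ dual to $\Phi(0,\dots,2,\dots,0)$ and $\eta_i\in\operatorname{Ext}^1_S(k,k)$ the class of the map $K_1\to k$ dual to $\Phi(0,\dots,1,\dots,0)$ (the $2$, respectively the $1$, in place $i$). Let $\operatorname{Ext}^*_S(k,k)=\bigoplus_n\operatorname{Ext}^n_S(k,k)$ carry the product given by composition of chain maps: if $f$ and $g$ are cocycles on a projective resolution and the chain map $\tilde g$ (commuting with the differentials) lifts $g$, then $[f][g]=[f\circ\tilde g]$. Then the $k$-algebra $\operatorname{Ext}^*_S(k,k)$ is generated by the $\xi_i$ (degree $2$) and the $\eta_i$ (degree $1$), $1\le i\le\theta$, and its defining relations are $$\xi_i\xi_j=q_{ji}^{N_iN_j}\xi_j\xi_i,\qquad \eta_i\xi_j=q_{ji}^{N_j}\xi_j\eta_i\qquad\text{for all } i,j,$$ $$\eta_i\eta_j=-q_{ji}\eta_j\eta_i\qquad\text{for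 } i\ne j,$$ $$\eta_i^2=0\ \text{ if } N_i\ne2,\qquad \eta_i^2=\xi_i\ \text{ if } N_i=2.$$ Moreover the monomials $\xi_1^{b_1}\cdots\xi_\theta^{b_\theta}\eta_1^{c_1}\cdots\eta_\theta^{c_\theta}$ with $b_i\ge0$ and $c_i\in\{0,1\}$ form a $k$-basis of $\operatorname{Ext}^*_S(k,k)$. -/

import Mathlib

open CategoryTheory CategoryTheory.Abelian
open scoped DirectSum

universe u

noncomputable section

namespace YonedaAlgebra

variable {C : Type*} [Category* C] [Abelian C] [HasExt.{u} C] {M : C}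

/-- The Yoneda product `x y` of `x ∈ Ext^m(M, M)` and `y ∈ Ext^n(M, M)`: first `y`, then `x`.

The sign makes this the product that is computed by composing chain maps: for a projective
resolution `P` of `M` and cocycles `f : P_m ⟶ M`, `g : P_n ⟶ M`, the product `[f] [g]` is the
class of `f ∘ g_m`, where `g_j : P_{j+n} ⟶ P_j` (`j ≥ 0`) commute with the differentials
and lift `g`. (`Ext.comp` composes morphisms `P ⟶ P⟦n⟧` into shifted complexes, whose
differential is `(-1)^n d`; the two differ by `(-1)^(m n)`.) -/
def yonedaMul {m n c : ℕ} (x : Ext M M m) (y : Ext M M n) (h : m + n = c) : Ext M M c :=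
  ((-1 : ℤ) ^ (m * n)) • y.comp x ((add_comm n m).trans h)

theorem comp_zsmul' {a b c : ℕ} (α : Ext M M a) (β : Ext M M b) (h : a + b = c) (r : ℤ) :
    α.comp (r • β) h = r • α.comp β h :=
  map_zsmul (α.precomp M h) r β

theorem zsmul_comp' {a b c : ℕ} (α : Ext M M a) (β : Ext M M b) (h : a + b = c) (r : ℤ) :
    (r • α).comp β h = r • α.comp β h :=
  map_zsmul (β.postcomp M h) r α

theorem yonedaMul_assoc {a b c ab bc s : ℕ} (x : Ext M M a) (y : Ext M M b) (z : Ext M M c)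
    (hab : a + b = ab) (hbc : b + c = bc) (h₁ : ab + c = s) (h₂ : a + bc = s) :
    yonedaMul (yonedaMul x y hab) z h₁ = yonedaMul x (yonedaMul y z hbc) h₂ := by
  subst hab hbc
  simp only [yonedaMul, comp_zsmul', zsmul_comp', smul_smul, ← pow_add]
  rw [Ext.comp_assoc z y x (add_comm c b) (add_comm b a) (by omega)]
  congr 2
  ring

theorem mk_yonedaMul {m n c c' : ℕ} (x : Ext M M m) (y : Ext M M n) (h : m + n = c)
    (h' : m + n = c') :
    (GradedMonoid.mk (A := fun n => Ext M M n) c (yonedaMul x y h)) =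
      GradedMonoid.mk c' (yonedaMul x y h') := by
  subst h h'; rfl

theorem mk_eq_of_eq {m n : ℕ} (h : m = n) (x : Ext M M m) (y : Ext M M n)
    (hxy : ∀ h' : n + 0 = m, x = y.comp (Ext.mk₀ (𝟙 M)) h') :
    (GradedMonoid.mk (A := fun n => Ext M M n) m x) = GradedMonoid.mk n y := by
  subst h
  rw [hxy rfl, Ext.comp_mk₀_id]

theorem comp_id_comp_id {m n : ℕ} (x : Ext M M m) (h : m + 0 = n) (h' : n + 0 = m) :
    (x.comp (Ext.mk₀ (𝟙 M)) h).comp (Ext.mk₀ (𝟙 M)) h' = x := by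
  subst h
  simp

instance gOne : GradedMonoid.GOne (fun n : ℕ => Ext M M n) := ⟨Ext.mk₀ (𝟙 M)⟩

instance gMul : GradedMonoid.GMul (fun n : ℕ => Ext M M n) := ⟨fun x y => yonedaMul x y rfl⟩

theorem gOne_def : (GradedMonoid.GOne.one : Ext M M 0) = Ext.mk₀ (𝟙 M) := rfl

theorem gMul_def {m n : ℕ} (x : Ext M M m) (y : Ext M M n) :
    GradedMonoid.GMul.mul (A := fun n => Ext M M n) x y = yonedaMul x y rfl := rfl

instance gMonoid : GradedMonoid.GMonoid (fun n : ℕ => Ext M M n) where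
  one_mul := by
    rintro ⟨n, x⟩
    refine mk_eq_of_eq (zero_add n) _ _ fun h' => ?_
    simp [gMul_def, gOne_def, yonedaMul]
  mul_one := by
    rintro ⟨n, x⟩
    refine mk_eq_of_eq (add_zero n) _ _ fun h' => ?_
    simp [gMul_def, gOne_def, yonedaMul]
  mul_assoc := by
    rintro ⟨a, x⟩ ⟨b, y⟩ ⟨c, z⟩
    change GradedMonoid.mk (a + b + c) (yonedaMul (yonedaMul x y rfl) z rfl) =
      GradedMonoid.mk (a + (b + c)) (yonedaMul x (yonedaMul y z rfl) rfl)
    rw [yonedaMul_assoc x y z rfl rfl rfl (add_assoc a b c).symm]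
    exact mk_yonedaMul _ _ _ _

/-- The Yoneda algebra `⨁ n, Ext M M n` is a graded ring under `yonedaMul`. -/
instance gSemiring : DirectSum.GSemiring (fun n : ℕ => Ext M M n) where
  mul_zero := by intros; simp [gMul_def, yonedaMul]
  zero_mul := by intros; simp [gMul_def, yonedaMul]
  mul_add := by intros; simp [gMul_def, yonedaMul]
  add_mul := by intros; simp [gMul_def, yonedaMul]
  natCast n := n • Ext.mk₀ (𝟙 M)
  natCast_zero := by simp
  natCast_succ n := by simp [add_smul, gOne_def]

/-- The Yoneda algebra `⨁ n, Ext M M n` is a `k`-algebra. -/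
instance gAlgebra (k : Type*) [Field k] [Linear k C] :
    DirectSum.GAlgebra k (fun n : ℕ => Ext M M n) where
  toFun :=
    { toFun := fun r => r • Ext.mk₀ (𝟙 M)
      map_zero' := by simp
      map_add' := fun r s => add_smul r s _ }
  map_one := by simp; rfl
  map_mul r s := by
    refine mk_eq_of_eq rfl _ _ fun h' => ?_
    simp [gMul_def, yonedaMul, smul_smul]
  commutes := by
    rintro r ⟨n, x⟩
    refine mk_eq_of_eq (m := 0 + n) (n := n + 0) (by omega)
      (yonedaMul (r • Ext.mk₀ (𝟙 M)) x rfl) (yonedaMul x (r • Ext.mk₀ (𝟙 M)) rfl) fun h' => ?_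
    simp [yonedaMul, Ext.comp_smul, Ext.smul_comp]
  smul_def := by
    rintro r ⟨n, x⟩
    refine mk_eq_of_eq (m := n) (n := 0 + n) (by omega)
      (r • x) (yonedaMul (r • Ext.mk₀ (𝟙 M)) x rfl) fun h' => ?_
    simp [yonedaMul, Ext.comp_smul, Ext.smul_comp, comp_id_comp_id]

end YonedaAlgebra

/-- The data of a quantum complete intersection over `k` in `θ` variables: exponents `N i > 1` and
nonzero scalars `q i j` for `i < j`, extended by `q j i = (q i j)⁻¹` and `q i i = 1`. -/
structure QCIData (k : Type u) [Field k] (θ : ℕ) where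
  N : Fin θ → ℕ
  one_lt_N : ∀ i, 1 < N i
  q : Fin θ → Fin θ → kˣ
  q_symm : ∀ i j, i < j → q j i = (q i j)⁻¹
  q_self : ∀ i, q i i = 1

namespace QCIData

variable {k : Type u} [Field k] {θ : ℕ} (D : QCIData k θ)

/-- The relations `x_i x_j = q_{ij} x_j x_i` for `i < j` and `x_i ^ N_i = 0`. -/
inductive Rel : FreeAlgebra k (Fin θ) → FreeAlgebra k (Fin θ) → Prop
  | comm (i j : Fin θ) (hij : i < j) :
      Rel (FreeAlgebra.ι k i * FreeAlgebra.ι k j)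
        ((D.q i j : k) • (FreeAlgebra.ι k j * FreeAlgebra.ι k i))
  | pow (i : Fin θ) : Rel (FreeAlgebra.ι k i ^ D.N i) 0

/-- The quantum complete intersection `S`. -/
abbrev S : Type u := RingQuot D.Rel

/-- The generator `x_i` of `S`. -/
def x (i : Fin θ) : D.S := RingQuot.mkAlgHom k D.Rel (FreeAlgebra.ι k i)

/-- The augmentation `ε : S → k`, `x_i ↦ 0`. -/
def ε : D.S →ₐ[k] k :=
  RingQuot.liftAlgHom k ⟨FreeAlgebra.lift k (fun _ : Fin θ => (0 : k)), by
    intro a b h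
    induction h with
    | comm i j hij => simp
    | pow i => simp [Nat.ne_of_gt (Nat.lt_of_succ_lt (D.one_lt_N i))]⟩

/-- The trivial `S`-module `k`: the field `k`, on which `S` acts through `ε`. -/
def Triv (_ : QCIData k θ) : Type u := k

instance : AddCommGroup D.Triv := inferInstanceAs (AddCommGroup k)

instance : Module D.S D.Triv := Module.compHom k D.ε.toRingHom

/-- The trivial module `k` as an object of the category of `S`-modules. -/
abbrev triv : ModuleCat.{u} D.S := ModuleCat.of D.S D.Triv

/-- The cohomology algebra `H^*(S, k) = Ext_S^*(k, k)` under the Yoneda product. -/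
abbrev H : Type u := ⨁ n : ℕ, Ext D.triv D.triv n

/-- `σ_i(a) = 1` if `a` is odd and `N_i - 1` if `a` is even. -/
def σ (i : Fin θ) (a : ℕ) : ℕ := if Odd a then 1 else D.N i - 1

/-- `τ_i(a) = σ_i(1) + ⋯ + σ_i(a)`. -/
def τ (i : Fin θ) (a : ℕ) : ℕ := ∑ j ∈ Finset.Icc 1 a, D.σ i j

/-- The free `S`-module `K_n` on the generators `Φ(a_1, …, a_θ)` with `a_1 + ⋯ + a_θ = n`. -/
abbrev K (n : ℕ) : Type u := {a : Fin θ → ℕ // ∑ i, a i = n} →₀ D.S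

/-- The generator `Φ(a)` of `K_n`, for `a` with `a_1 + ⋯ + a_θ = n`. -/
def Φ (n : ℕ) (a : Fin θ → ℕ) : D.K n :=
  if h : ∑ i, a i = n then Finsupp.single ⟨a, h⟩ 1 else 0

/-- The scalar `∏_{l < i} (-1)^{a_l} q_{li}^{σ_i(a_i) τ_l(a_l)}`. -/
def dCoeff (i : Fin θ) (a : Fin θ → ℕ) : k :=
  ∏ l ∈ Finset.Iio i, (-1) ^ a l * (D.q l i : k) ^ (D.σ i (a i) * D.τ l (a l))

/-- The differential `d = d_1 + ⋯ + d_θ : K_{n+1} → K_n`, where `d_i` sends `Φ(a)` to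
`dCoeff i a • x_i^{σ_i(a_i)} Φ(a_1, …, a_i - 1, …, a_θ)` if `a_i > 0` and to `0` otherwise. -/
def dK (n : ℕ) : D.K (n + 1) →ₗ[D.S] D.K n :=
  Finsupp.linearCombination D.S fun a => ∑ i, if a.1 i = 0 then 0 else
    (D.dCoeff i a.1 • D.x i ^ D.σ i (a.1 i)) • D.Φ n (Function.update a.1 i (a.1 i - 1))

/-- The `S`-linear function `K_n → k` dual to the generator `Φ(b)`: it sends `Φ(b)` to `1`
and every other generator to `0`. -/
def dual (n : ℕ) (b : Fin θ → ℕ) : D.K n →ₗ[D.S] D.Triv :=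
  Finsupp.linearCombination D.S fun a => (show D.Triv from if a.1 = b then (1 : k) else 0)

/-- The augmentation `K_0 = S Φ(0, …, 0) → k`, which sends `Φ(0, …, 0)` to `1`. -/
def augK : D.K 0 →ₗ[D.S] D.Triv := D.dual 0 0

/-- A projective resolution of the `S`-module `k` whose terms, differentials and augmentation are
those of `(K, d)`. -/
structure Resolution where
  res : ProjectiveResolution D.triv
  iso : ∀ n, res.complex.X n ≅ ModuleCat.of D.S (D.K n)
  d_iso : ∀ n, res.complex.d (n + 1) n ≫ (iso n).hom = (iso (n + 1)).hom ≫ ModuleCat.ofHom (D.dK n)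
  π_iso : res.π.f 0 = (iso 0).hom ≫ ModuleCat.ofHom D.augK ≫
    (HomologicalComplex.singleObjXSelf (ComplexShape.down ℕ) 0 D.triv).inv

theorem σ_pos (i : Fin θ) (a : ℕ) : D.σ i a ≠ 0 := by
  have := D.one_lt_N i
  unfold σ
  split_ifs <;> omega

theorem ε_x (i : Fin θ) : D.ε (D.x i) = 0 := by
  simp [ε, x]

theorem smul_triv (s : D.S) (c : D.Triv) :
    s • c = (show D.Triv from D.ε s * (show k from c)) := rfl

/-- Since `x_i ^ σ_i(a)` lies in the augmentation ideal, every dual function is a cocycle. -/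
theorem dual_dK (n : ℕ) (b : Fin θ → ℕ) : (D.dual n b).comp (D.dK n) = 0 := by
  refine Finsupp.lhom_ext' fun a => LinearMap.ext_ring ?_
  simp only [dK, LinearMap.comp_apply, Finsupp.lsingle_apply, Finsupp.linearCombination_single,
    one_smul, map_sum, LinearMap.zero_comp, LinearMap.zero_apply]
  refine Finset.sum_eq_zero fun i _ => ?_
  split_ifs
  · exact map_zero _
  · rw [map_smul, smul_triv]
    have h : D.ε (D.dCoeff i a.1 • D.x i ^ D.σ i (a.1 i)) = 0 := by simp [ε_x, σ_pos]
    rw [h]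
    exact zero_mul (M₀ := k) _

namespace Resolution

variable {D} (P : D.Resolution)

/-- The class in `H^n(S, k)` of the function `K_n → k` dual to `Φ(b)`. -/
def dualClass (n : ℕ) (b : Fin θ → ℕ) : Ext D.triv D.triv n :=
  P.res.extMk ((P.iso n).hom ≫ ModuleCat.ofHom (D.dual n b)) (n + 1) rfl (by
    rw [← Category.assoc, P.d_iso, Category.assoc, ← ModuleCat.ofHom_comp, dual_dK]
    simp)

/-- `ξ_i ∈ H^2(S, k)` is the class of the function dual to `Φ(0, …, 2, …, 0)`. -/
def ξ (i : Fin θ) : D.H :=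
  DirectSum.of (fun n : ℕ => Ext D.triv D.triv n) 2 (P.dualClass 2 (Pi.single i 2))

/-- `η_i ∈ H^1(S, k)` is the class of the function dual to `Φ(0, …, 1, …, 0)`. -/
def η (i : Fin θ) : D.H :=
  DirectSum.of (fun n : ℕ => Ext D.triv D.triv n) 1 (P.dualClass 1 (Pi.single i 1))

end Resolution

/-- The free generator `ξ_i` of the presentation of `H^*(S, k)`. -/
abbrev Xi (i : Fin θ) : FreeAlgebra k (Fin θ ⊕ Fin θ) := FreeAlgebra.ι k (Sum.inl i)

/-- The free generator `η_i` of the presentation of `H^*(S, k)`. -/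
abbrev Eta (i : Fin θ) : FreeAlgebra k (Fin θ ⊕ Fin θ) := FreeAlgebra.ι k (Sum.inr i)

/-- The relations between the `ξ_i` and `η_i`. -/
inductive CohRel : FreeAlgebra k (Fin θ ⊕ Fin θ) → FreeAlgebra k (Fin θ ⊕ Fin θ) → Prop
  | ξξ (i j : Fin θ) :
      CohRel (Xi i * Xi j) (((D.q j i : k) ^ (D.N i * D.N j)) • (Xi j * Xi i))
  | ηξ (i j : Fin θ) : CohRel (Eta i * Xi j) (((D.q j i : k) ^ D.N j) • (Xi j * Eta i))
  | ηη (i j : Fin θ) (hij : i ≠ j) : CohRel (Eta i * Eta j) ((-(D.q j i : k)) • (Eta j * Eta i))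
  | η_sq (i : Fin θ) (hi : D.N i ≠ 2) : CohRel (Eta i * Eta i) 0
  | η_sq_two (i : Fin θ) (hi : D.N i = 2) : CohRel (Eta i * Eta i) (Xi i)

end QCIData

end

/-! ### Yoneda products computed by chain maps of a projective resolution -/

section ChainMaps

open CochainComplex HomComplex

/-! The complex `K` has an explicit contracting homotopy over `k`. The monomials `x_θ^{m_θ} ⋯
x_1^{m_1}` with `m_i < N_i` form a basis of `S` (`monoBasis`), so the vectors `x^m Φ(a)` form a
basis of `K_n`. In this basis `d_i` adds `σ_i(a_i)` to `m_i` and lowers `a_i` by one. The homotopy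
undoes this move, when possible, at the least index where `m` or `a` is nonzero. There the
coefficient of `d_i` is `1`, and the moves at later indices anticommute with it (`dK_contract`).
Hence `K` is a free resolution.

The coefficients of `d` lie in the augmentation ideal, so every function `K_n → k` is a cocycle and
every coboundary is zero. The classes `gen a` dual to the `Φ(a)` therefore form a basis of the
cohomology (`genBasis`).

To multiply by `ξ_i` or `η_i` on the right it suffices to lift the cocycle to a chain map of `K`
(`yonedaMul_extMk`). The lift of `ξ_i` sends `Φ(a)` to a scalar times `Φ(a - 2e_i)`, that of `η_i`
sends it to a scalar times `x_i^{σ_i(a_i)-1} Φ(a - e_i)` (`dK_comp_liftξ`, `dK_comp_liftη`). So `gen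
b * ξ_i` is a nonzero multiple of `gen (b + 2e_i)`. Likewise `gen b * η_i` is a nonzero multiple of
`gen (b + e_i)` if `σ_i(b_i+1) = 1`, and zero otherwise. Comparing scalars gives the relations. The
ordered monomial with exponents `e` and `c` is a nonzero multiple of `gen (2e + c)`, so these
monomials form a basis.

In the presented algebra the relations suffice to rewrite everything as a combination of ordered
monomials (`cohSpan_eq_top`). The map to the cohomology sends this spanning family to a basis, so it
is bijective. -/

theorem CochainComplex.HomComplex.Cocycle.equivHomShift_symm_comp
    {C : Type*} [Category* C] [Preadditive C] {K L M : CochainComplex C ℤ}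
    {a b c : ℤ} (α : Cocycle K L a) (β : Cocycle L M b) (γ : Cocycle K M c) (h : a + b = c)
    (hγ : γ.1 = α.1.comp β.1 h) :
    (ShiftedHom.comp (Cocycle.equivHomShift.symm α) (Cocycle.equivHomShift.symm β)
      (by omega) : ShiftedHom K M c) = Cocycle.equivHomShift.symm γ := by
  subst h
  apply HomologicalComplex.Hom.ext
  funext p
  -- Passing from a cocycle to a morphism into a shifted complex introduces no sign, only an
  -- identification of objects.
  have key {N₁ N₂ : CochainComplex C ℤ} {d : ℤ} (ζ : Cocycle N₁ N₂ d) (i j : ℤ) (hj : i + d = j) :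
      (Cocycle.equivHomShift.symm ζ).f i =
        ζ.1.v i j hj ≫ (N₂.shiftFunctorObjXIso d i j hj.symm).inv := by
    subst hj
    exact (Cochain.rightShift_v ζ.1 d 0 (zero_add d) i i (add_zero i) (i + d) rfl)
  simp only [ShiftedHom.comp, HomologicalComplex.comp_f]
  rw [key γ p (p + (a + b)) rfl, key α p (p + a) rfl, hγ,
    Cochain.comp_v α.1 β.1 rfl p (p + a) (p + (a + b)) rfl (by omega)]
  have e : ((Cocycle.equivHomShift.symm β)⟦a⟧').f p = β.1.v (p + a) (p + (a + b)) (by omega) ≫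
      (M.shiftFunctorObjXIso b (p + a) (p + (a + b)) (by omega)).inv :=
    key β (p + a) (p + (a + b)) (by omega)
  rw [e, CochainComplex.shiftFunctorAdd'_inv_app_f']
  have aux {W₁ W₂ W₃ W₄ : C} (f : W₁ ⟶ W₂) (g : W₂ ⟶ W₃) (i : W₄ ≅ W₃) :
      (f ≫ 𝟙 W₂) ≫ (g ≫ i.inv) ≫ i.hom = (f ≫ g) ≫ 𝟙 W₃ := by simp
  have e₁ : L.shiftFunctorObjXIso a p (p + a) rfl = Iso.refl _ := rfl
  have e₂ : M.shiftFunctorObjXIso (a + b) p (p + (a + b)) rfl = Iso.refl _ := rfl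
  rw [e₁, e₂]
  exact aux _ _ (M.XIsoOfEq _)

namespace CategoryTheory.ProjectiveResolution
variable {C : Type*} [Category* C] [Abelian C]
  {X Y : C} (R : ProjectiveResolution X)

/-- The cochain of degree `n` of the complex `R` with components `(-1)^(n m) φ m`. -/
noncomputable def liftCochain (n : ℕ) (φ : ∀ m, R.complex.X (n + m) ⟶ R.complex.X m) :
    Cochain R.cochainComplex R.cochainComplex n :=
  Cochain.mk fun p q hpq =>
    if h : q ≤ 0 then
      ((-1 : ℤ) ^ (n * (-q).toNat)) • ((R.cochainComplexXIso p (n + (-q).toNat) (by omega)).hom ≫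
        φ (-q).toNat ≫ (R.cochainComplexXIso q (-q).toNat (by omega)).inv)
    else 0

theorem liftCochain_v (n : ℕ) (φ : ∀ m, R.complex.X (n + m) ⟶ R.complex.X m) (m : ℕ) (p q : ℤ)
    (hp : -((n + m : ℕ) : ℤ) = p) (hq : -(m : ℤ) = q) (hpq : p + n = q) :
    (R.liftCochain n φ).v p q hpq = ((-1 : ℤ) ^ (n * m)) • ((R.cochainComplexXIso p (n + m) hp).hom ≫
        φ m ≫ (R.cochainComplexXIso q m hq).inv) := by
  obtain rfl : m = (-q).toNat := by omega
  simp [liftCochain, show q ≤ 0 by omega]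

/-- The coboundary of a degree `n` cochain carries a sign depending on `n`. The factor `(-1)^(n m)`
changes by `(-1)^n` from one component to the next, and this turns commutation with `d` into the
cocycle condition. -/
theorem δ_liftCochain (n : ℕ) (φ : ∀ m, R.complex.X (n + m) ⟶ R.complex.X m)
    (hφ : ∀ m, φ (m + 1) ≫ R.complex.d (m + 1) m = R.complex.d (n + m + 1) (n + m) ≫ φ m) :
    δ n (n + 1) (R.liftCochain n φ) = 0 := by
  ext p q hpq
  rw [δ_v n (n + 1) rfl _ p q hpq (q - 1) (p + 1) rfl rfl]
  by_cases hq : q ≤ 0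
  · obtain ⟨m, rfl⟩ := Int.exists_eq_neg_ofNat hq
    rw [R.liftCochain_v n φ (m + 1) _ _ (by push_cast; omega) (by push_cast; omega),
      R.liftCochain_v n φ m _ _ (by push_cast; omega) rfl,
      R.cochainComplex_d _ _ (m + 1) m (by push_cast; omega) rfl,
      R.cochainComplex_d _ _ (n + m + 1) (n + m) (by push_cast; omega) (by push_cast; omega)]
    simp only [Preadditive.zsmul_comp, Preadditive.comp_zsmul, Category.assoc, Iso.inv_hom_id_assoc]
    rw [reassoc_of% (hφ m), Int.negOnePow_succ]
    simp only [Cochain.zero_v]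
    rw [mul_add, mul_one, pow_add, Units.neg_smul, Int.negOnePow_def, zpow_natCast, Units.smul_def,
      smul_smul]
    push_cast
    rw [mul_comm]
    exact add_neg_cancel _
  -- For `q > 0` the target is zero: the resolution lives in degrees at most `0`.
  · exact (CochainComplex.isZero_of_isStrictlyLE _ 0 _ (by omega)).eq_of_tgt _ _

/-- The cocycle of degree `n` of the complex `R` with components `(-1)^(n m) φ m`. -/
noncomputable def liftCocycle (n : ℕ) (φ : ∀ m, R.complex.X (n + m) ⟶ R.complex.X m)
    (hφ : ∀ m, φ (m + 1) ≫ R.complex.d (m + 1) m = R.complex.d (n + m + 1) (n + m) ≫ φ m) :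
    Cocycle R.cochainComplex R.cochainComplex n :=
  Cocycle.mk (R.liftCochain n φ) _ rfl (R.δ_liftCochain n φ hφ)

/-- The cocycle with values in a single complex that is attached to `f`. -/
noncomputable def singleCocycle {n : ℕ} (f : R.complex.X n ⟶ Y)
    (hf : R.complex.d (n + 1) n ≫ f = 0) :
    Cocycle R.cochainComplex ((singleFunctor C 0).obj Y) n :=
  Cocycle.toSingleMk ((R.cochainComplexXIso (-n) n rfl).hom ≫ f) (by simp)
      (-(n + 1 : ℕ)) (by omega) (by rw [R.cochainComplex_d _ _ _ n rfl rfl]; simp [hf])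

/-- A map into a complex concentrated in degree `0` is determined by one component. This is the
component `m = 0`, where the sign `(-1)^(n m)` is `1`. -/
theorem liftCocycle_postcomp {n : ℕ} (φ : ∀ m, R.complex.X (n + m) ⟶ R.complex.X m)
    (hφ : ∀ m, φ (m + 1) ≫ R.complex.d (m + 1) m = R.complex.d (n + m + 1) (n + m) ≫ φ m)
    (g : R.complex.X n ⟶ X) (hg : R.complex.d (n + 1) n ≫ g = 0) (h : φ 0 ≫ R.π.f 0 ≫
      (HomologicalComplex.singleObjXSelf (.down ℕ) 0 X).hom = g) :
    (R.liftCocycle n φ hφ).postcomp R.π' = R.singleCocycle g hg := by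
  ext : 1
  apply (Cochain.toSingleEquiv (p := (-n : ℤ)) (q := 0) (n := n) (by simp)).injective
  have hv := R.liftCochain_v n φ 0 (-n) 0 (by simp) (by simp) (by simp)
  have h : φ 0 ≫ R.π.f 0 ≫ 𝟙 X = g := h
  subst h
  simp only [Cochain.toSingleEquiv, liftCocycle, singleCocycle, AddEquiv.coe_mk, Equiv.coe_fn_mk,
    Cocycle.postcomp_coe, Cocycle.mk_coe, Cochain.comp_zero_cochain_v, hv, Cochain.ofHom_v,
    π'_f_zero, Cocycle.toSingleMk_coe, Cochain.toSingleMk_v, mul_zero, pow_zero, one_smul]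
  have aux {W₁ W₂ W₃ W₄ W₅ W₆ : C} (f₁ : W₁ ⟶ W₂) (f₂ : W₂ ⟶ W₃) (f₃ : W₄ ≅ W₃) (f₄ : W₃ ⟶ W₅)
      (f₅ : W₅ ⟶ W₆) : (f₁ ≫ f₂ ≫ f₃.inv) ≫ f₃.hom ≫ f₄ ≫ f₅ = (f₁ ≫ f₂ ≫ f₄ ≫ 𝟙 _) ≫ f₅ := by
    simp
  exact congrArg (· ≫ _) (aux _ _ _ _ _)


/-- Only the component `φ m` meets `f`, and it brings along its sign `(-1)^(n m)`. -/
theorem liftCocycle_comp_singleCocycle {n m : ℕ} (φ : ∀ m, R.complex.X (n + m) ⟶ R.complex.X m)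
    (hφ : ∀ m, φ (m + 1) ≫ R.complex.d (m + 1) m = R.complex.d (n + m + 1) (n + m) ≫ φ m)
    (f : R.complex.X m ⟶ Y) (hf : R.complex.d (m + 1) m ≫ f = 0)
    (hf' : R.complex.d (n + m + 1) (n + m) ≫ (((-1 : ℤ) ^ (n * m)) • (φ m ≫ f)) = 0) :
    (R.singleCocycle (((-1 : ℤ) ^ (n * m)) • (φ m ≫ f)) hf').1 =
      (R.liftCocycle n φ hφ).1.comp (R.singleCocycle f hf).1 (by simp) := by
  apply (Cochain.toSingleEquiv (p := (-(n + m : ℕ) : ℤ)) (q := 0) (by simp)).injective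
  have hv := R.liftCochain_v n φ m (-(n + m : ℕ)) (-m) rfl rfl (by simp)
  have hs := Cochain.toSingleMk_v ((R.cochainComplexXIso (-m) m rfl).hom ≫ f) (n := m)
    (neg_add_cancel (m : ℤ))
  simp only [Cochain.toSingleEquiv, liftCocycle, singleCocycle, AddEquiv.coe_mk, Equiv.coe_fn_mk,
    Cocycle.mk_coe, Cocycle.toSingleMk_coe, Cochain.toSingleMk_v]
  rw [Cochain.comp_v _ _ _ (-(n + m : ℕ)) (-m) 0 (by simp) (by simp), hv, hs]
  refine congrArg (· ≫ _) ?_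
  have aux {W₁ W₂ W₃ W₄ W₅ W₆ : C} (z : ℤ) (a : W₁ ⟶ W₂) (b : W₂ ⟶ W₃) (i : W₄ ≅ W₃) (c : W₃ ⟶ W₅)
      (d : W₅ ⟶ W₆) : (a ≫ (z • (b ≫ c))) ≫ d = (z • a ≫ b ≫ i.inv) ≫ (i.hom ≫ c) ≫ d := by simp
  exact aux _ _ _ _ _ _

variable [HasExt.{u} C]

/-- In the derived category the class is a roof: invert the quasi-isomorphism `R.π'`, then apply the
cocycle. Products can then be computed on cocycles of the resolution. -/
theorem extMk_hom_eq [HasDerivedCategory C] {n : ℕ} (f : R.complex.X n ⟶ Y)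
    (hf : R.complex.d (n + 1) n ≫ f = 0) :
    (R.extMk f _ rfl hf).hom = ((DerivedCategory.singleFunctorIsoCompQ C 0).hom.app X ≫
      inv (DerivedCategory.Q.map R.π')) ≫
        ShiftedHom.map (Cocycle.equivHomShift.symm (R.singleCocycle f hf)) DerivedCategory.Q ≫
          ((DerivedCategory.singleFunctorIsoCompQ C 0).inv.app Y)⟦(n : ℤ)⟧' := by
  rw [R.extMk_hom f (n + 1) rfl hf, ShiftedHom.mk₀_comp, ShiftedHom.comp_mk₀]
  rfl

theorem extMk_comp_extMk_aux {n m : ℕ} (φ : ∀ m, R.complex.X (n + m) ⟶ R.complex.X m)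
    (hφ : ∀ m, φ (m + 1) ≫ R.complex.d (m + 1) m = R.complex.d (n + m + 1) (n + m) ≫ φ m)
    (g : R.complex.X n ⟶ X) (hg : R.complex.d (n + 1) n ≫ g = 0) (h : φ 0 ≫ R.π.f 0 ≫
      (HomologicalComplex.singleObjXSelf (.down ℕ) 0 X).hom = g)
    (f : R.complex.X m ⟶ Y) (hf : R.complex.d (m + 1) m ≫ f = 0)
    (hf' : R.complex.d (n + m + 1) (n + m) ≫ (((-1 : ℤ) ^ (n * m)) • (φ m ≫ f)) = 0) :
    (R.extMk g _ rfl hg).comp (R.extMk f _ rfl hf) rfl =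
      R.extMk (((-1 : ℤ) ^ (n * m)) • (φ m ≫ f)) _ rfl hf' := by
  let := HasDerivedCategory.standard C
  ext
  have hG (G : ShiftedHom R.cochainComplex R.cochainComplex (n : ℤ)) :
      ShiftedHom.map (G ≫ R.π'⟦(n : ℤ)⟧' : ShiftedHom R.cochainComplex _ (n : ℤ))
        DerivedCategory.Q = ShiftedHom.map G DerivedCategory.Q ≫
          (DerivedCategory.Q.map R.π')⟦(n : ℤ)⟧' := by
    rw [← ShiftedHom.comp_mk₀ G (0 : ℤ) rfl, ShiftedHom.map_comp, ShiftedHom.map_mk₀,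
      ShiftedHom.comp_mk₀]
  rw [Ext.comp_hom, R.extMk_hom_eq g hg, R.extMk_hom_eq f hf, R.extMk_hom_eq _ hf',
    ← R.liftCocycle_postcomp φ hφ g hg h, Cocycle.equivHomShift_symm_postcomp,
    ← Cocycle.equivHomShift_symm_comp (R.liftCocycle n φ hφ) (R.singleCocycle f hf) _ (by simp)
      (R.liftCocycle_comp_singleCocycle φ hφ f hf hf'), ShiftedHom.map_comp,
    hG]
  simp only [ShiftedHom.comp, Category.assoc, Functor.map_comp]
  -- The augmentation at the end of the lifted first class cancels the inverse augmentation at the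
  -- start of the second.
  have hπ : (DerivedCategory.Q.map R.π')⟦(n : ℤ)⟧' ≫
      ((DerivedCategory.singleFunctorIsoCompQ C 0).inv.app X)⟦(n : ℤ)⟧' ≫
      ((DerivedCategory.singleFunctorIsoCompQ C 0).hom.app X)⟦(n : ℤ)⟧' ≫
      (inv (DerivedCategory.Q.map R.π'))⟦(n : ℤ)⟧' = 𝟙 _ := by
    simp only [← Functor.map_comp, Iso.inv_hom_id_app_assoc]
    simp
  rw [reassoc_of% hπ]
  congr 4
  rw [← NatTrans.naturality]
  rfl

theorem extMk_comp_extMk {n m : ℕ} (φ : ∀ m, R.complex.X (n + m) ⟶ R.complex.X m)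
    (hφ : ∀ m, φ (m + 1) ≫ R.complex.d (m + 1) m = R.complex.d (n + m + 1) (n + m) ≫ φ m)
    (g : R.complex.X n ⟶ X) (hg : R.complex.d (n + 1) n ≫ g = 0) (h : φ 0 ≫ R.π.f 0 ≫
      (HomologicalComplex.singleObjXSelf (.down ℕ) 0 X).hom = g)
    (f : R.complex.X m ⟶ Y) (hf : R.complex.d (m + 1) m ≫ f = 0)
    (hf' : R.complex.d (n + m + 1) (n + m) ≫ φ m ≫ f = 0) :
    (R.extMk g _ rfl hg).comp (R.extMk f _ rfl hf) rfl =
      ((-1 : ℤ) ^ (n * m)) • R.extMk (φ m ≫ f) _ rfl hf' := by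
  rw [R.extMk_comp_extMk_aux φ hφ g hg h f hf (by rw [Preadditive.comp_zsmul, hf', smul_zero])]
  obtain e | e := neg_one_pow_eq_or ℤ (n * m)
  · simp only [e, one_smul]
  · simp only [e, neg_smul, one_smul, neg_extMk]

/-- A coboundary in degree `0` would factor through the term of cohomological degree `1`, which is
zero. -/
theorem extMk_zero_injective (f : R.complex.X 0 ⟶ Y) (hf : R.complex.d 1 0 ≫ f = 0)
    (h : R.extMk f 1 rfl hf = 0) : f = 0 := by
  rw [← R.extEquivCohomologyClass.apply_eq_iff_eq, extEquivCohomologyClass_extMk,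
    extEquivCohomologyClass_zero, CohomologyClass.mk_eq_zero_iff,
    Cocycle.toSingleMk_mem_coboundaries_iff _ _ _ _ _ 1 (by simp)] at h
  obtain ⟨g, hg⟩ := h
  have hz : Limits.IsZero (R.cochainComplex.X 1) :=
    CochainComplex.isZero_of_isStrictlyLE _ 0 _ (by omega)
  rw [hz.eq_of_src g 0, Limits.comp_zero] at hg
  rw [← cancel_epi (R.cochainComplexXIso (-(0 : ℕ)) 0 rfl).hom, ← hg, Limits.comp_zero]

theorem smul_extMk {k : Type*} [Field k] [Linear k C] {n : ℕ} (r : k) (f : R.complex.X n ⟶ Y)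
    (hf : R.complex.d (n + 1) n ≫ f = 0) (hf' : R.complex.d (n + 1) n ≫ (r • f) = 0) :
    R.extMk (r • f) _ rfl hf' = r • R.extMk f _ rfl hf := by
  rw [Ext.smul_eq_comp_mk₀, extMk_comp_mk₀]
  congr 1
  simp

end CategoryTheory.ProjectiveResolution

namespace YonedaAlgebra
variable {C : Type*} [Category* C] [Abelian C] [HasExt.{u} C]
  {X : C} (R : ProjectiveResolution X)

/-- The product in the Yoneda algebra is computed by lifting cocycles to chain maps. -/
theorem yonedaMul_extMk {n m : ℕ} (φ : ∀ m, R.complex.X (n + m) ⟶ R.complex.X m)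
    (hφ : ∀ m, φ (m + 1) ≫ R.complex.d (m + 1) m = R.complex.d (n + m + 1) (n + m) ≫ φ m)
    (g : R.complex.X n ⟶ X) (hg : R.complex.d (n + 1) n ≫ g = 0) (h : φ 0 ≫ R.π.f 0 ≫
      (HomologicalComplex.singleObjXSelf (.down ℕ) 0 X).hom = g)
    (f : R.complex.X m ⟶ X) (hf : R.complex.d (m + 1) m ≫ f = 0)
    (hf' : R.complex.d (n + m + 1) (n + m) ≫ φ m ≫ f = 0) :
    yonedaMul (R.extMk f _ rfl hf) (R.extMk g _ rfl hg) (add_comm m n) =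
      R.extMk (φ m ≫ f) _ rfl hf' := by
  rw [yonedaMul, R.extMk_comp_extMk φ hφ g hg h f hf hf', smul_smul, mul_comm n m, ← mul_pow]
  simp

end YonedaAlgebra

end ChainMaps

noncomputable section

/-! ### Ordered monomials in elements that commute up to scalars -/

section OrderedMonomials

variable {k A ι : Type*} [Field k] [Ring A] [Algebra k A]

theorem List.prod_map_pow_mul_of_qcomm (z : ι → A) (c : ι → k) (f : ι → ℕ) (y : A) (l : List ι)
    (h : ∀ i ∈ l, z i * y = c i • (y * z i)) :
    (l.map fun i => z i ^ f i).prod * y =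
      (l.map fun i => c i ^ f i).prod • (y * (l.map fun i => z i ^ f i).prod) := by
  have hp (i) (hi : z i * y = c i • (y * z i)) (t : ℕ) : z i ^ t * y = c i ^ t • (y * z i ^ t) := by
    induction t with
    | zero => simp
    | succ t ih =>
      rw [pow_succ, mul_assoc, hi, mul_smul_comm, ← mul_assoc, ih, smul_mul_assoc, smul_smul,
        mul_assoc, pow_succ']
  induction l with
  | nil => simp
  | cons a l ih =>
    simp only [List.map_cons, List.prod_cons]
    rw [mul_assoc, ih fun i hi => h i (by simp [hi]), mul_smul_comm, ← mul_assoc,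
      hp a (h a (by simp)), smul_mul_assoc, smul_smul, mul_comm, mul_assoc]

/-- The new factor has to pass only the factors in `l₂`, which stand to the right of its own place.
-/
theorem List.prod_map_pow_mul [DecidableEq ι] (z : ι → A) (c : ι → k) (f : ι → ℕ) (j : ι)
    (l₁ l₂ : List ι) (h₁ : j ∉ l₁) (h₂ : j ∉ l₂)
    (h : ∀ i ∈ l₂, z i * z j = c i • (z j * z i)) :
    ((l₁ ++ j :: l₂).map fun i => z i ^ f i).prod * z j = (l₂.map fun i => c i ^ f i).prod •
      ((l₁ ++ j :: l₂).map fun i => z i ^ (f + (Pi.single j 1 : ι → ℕ)) i).prod := by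
  have e (l : List ι) (hl : j ∉ l) :
      (l.map fun i => z i ^ (f + (Pi.single j 1 : ι → ℕ)) i) = l.map fun i => z i ^ f i := by
    refine List.map_congr_left fun i hi => ?_
    simp [show i ≠ j by rintro rfl; exact hl hi]
  simp only [List.map_append, List.map_cons, List.prod_append, List.prod_cons, e l₁ h₁, e l₂ h₂]
  rw [mul_assoc, mul_assoc, List.prod_map_pow_mul_of_qcomm z c f _ l₂ h]
  simp [pow_succ, mul_assoc]

end OrderedMonomials

theorem Pi.nat_induction_single {ι : Type*} [Fintype ι] [DecidableEq ι] {p : (ι → ℕ) → Prop}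
    (h0 : p 0) (h : ∀ m j, p m → p (m + Pi.single j 1)) (m : ι → ℕ) : p m := by
  induction hs : ∑ i, m i generalizing m with
  | zero =>
    obtain rfl : m = 0 := by
      ext i
      exact (Finset.sum_eq_zero_iff.1 hs) i (Finset.mem_univ i)
    exact h0
  | succ n ih =>
    obtain ⟨j, hj⟩ : ∃ j, m j ≠ 0 := by
      by_contra! hc
      simp [hc] at hs
    have hm : m = (m - Pi.single j 1) + Pi.single j 1 := by
      ext i
      obtain rfl | hij := eq_or_ne i j
      · simp only [Pi.add_apply, Pi.sub_apply, Pi.single_eq_same]; omega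
      · simp [hij]
    rw [hm]
    refine h _ _ (ih _ ?_)
    rw [hm] at hs
    simpa [Finset.sum_add_distrib] using hs

/-! ### The monomial basis of `S` -/

namespace QCIData

variable {k : Type u} [Field k] {θ : ℕ} (D : QCIData k θ)

theorem q_inv (i j : Fin θ) : D.q j i = (D.q i j)⁻¹ := by
  obtain h | rfl | h := lt_trichotomy i j
  · exact D.q_symm i j h
  · simp [D.q_self]
  · rw [D.q_symm j i h, inv_inv]

theorem q_mul_q (i j : Fin θ) : (D.q i j : k) * D.q j i = 1 := by
  rw [D.q_inv i j, Units.mul_inv]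

theorem x_mul_x_of_lt {i j : Fin θ} (h : i < j) :
    D.x i * D.x j = (D.q i j : k) • (D.x j * D.x i) := by
  simpa [x] using RingQuot.mkAlgHom_rel k (Rel.comm (D := D) i j h)

theorem x_mul_x (i j : Fin θ) : D.x i * D.x j = (D.q i j : k) • (D.x j * D.x i) := by
  obtain h | rfl | h := lt_trichotomy i j
  · exact D.x_mul_x_of_lt h
  · simp [D.q_self]
  · rw [D.x_mul_x_of_lt h, smul_smul, q_mul_q, one_smul]

theorem x_pow_N (i : Fin θ) : D.x i ^ D.N i = 0 := by
  simpa [x] using RingQuot.mkAlgHom_rel k (Rel.pow (D := D) i)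

theorem x_pow_mul_x_pow (i j : Fin θ) (s t : ℕ) :
    D.x i ^ s * D.x j ^ t = (D.q i j : k) ^ (s * t) • (D.x j ^ t * D.x i ^ s) := by
  have h1 (t : ℕ) : D.x i * D.x j ^ t = (D.q i j : k) ^ t • (D.x j ^ t * D.x i) := by
    induction t with
    | zero => simp
    | succ t ih =>
      rw [pow_succ, ← mul_assoc, ih, smul_mul_assoc, mul_assoc, x_mul_x, mul_smul_comm, smul_smul,
        ← mul_assoc, pow_succ]
  induction s with
  | zero => simp
  | succ s ih =>
    rw [pow_succ, mul_assoc, h1, mul_smul_comm, ← mul_assoc, ih, smul_mul_assoc, smul_smul,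
      mul_assoc, ← pow_add]
    congr 2
    ring

/-- The ordered monomial `x_θ^{m_θ} ⋯ x_1^{m_1}`. -/
def mono (m : Fin θ → ℕ) : D.S := ((List.finRange θ).reverse.map fun i => D.x i ^ m i).prod

/-- The scalar that arises when `x_j` is moved into the ordered monomial with exponents `m`. -/
def monoCoeff (j : Fin θ) (m : Fin θ → ℕ) : k := ∏ l ∈ Finset.Iio j, (D.q l j : k) ^ m l

theorem monoCoeff_ne_zero (j : Fin θ) (m : Fin θ → ℕ) : D.monoCoeff j m ≠ 0 :=
  Finset.prod_ne_zero_iff.2 fun _ _ => pow_ne_zero _ (Units.ne_zero _)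

theorem monoCoeff_add_single (i j : Fin θ) (m : Fin θ → ℕ) (t : ℕ) :
    D.monoCoeff j (m + Pi.single i t) =
      D.monoCoeff j m * if i < j then (D.q i j : k) ^ t else 1 := by
  simp only [monoCoeff, Pi.add_apply, pow_add, Finset.prod_mul_distrib]
  congr 1
  split_ifs with h
  · rw [Finset.prod_eq_single_of_mem i (by simpa using h) fun l _ hl => by simp [hl]]
    simp
  · refine Finset.prod_eq_one fun l hl => ?_
    rw [Pi.single_eq_of_ne (by rintro rfl; exact h (by simpa using hl)), pow_zero]

/-- In the decreasing order `x_θ ⋯ x_1` the variables to the right of `x_j` are the `x_l` with `l <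
j`. The scalar is thus a product over `l < j`, as in the differential of `K`. -/
theorem mono_mul_x (m : Fin θ → ℕ) (j : Fin θ) :
    D.mono m * D.x j = D.monoCoeff j m • D.mono (m + Pi.single j 1) := by
  obtain ⟨l₁, l₂, hl⟩ := List.append_of_mem (a := j) (l := (List.finRange θ).reverse) (by simp)
  have hs : (l₁ ++ j :: l₂).Pairwise (· > ·) := by
    rw [← hl, List.pairwise_reverse]
    exact List.pairwise_lt_finRange θ
  have hs' := List.pairwise_append.1 hs
  have h2 := List.pairwise_cons.1 hs'.2.1
  have hn : l₂.Nodup := h2.2.imp (fun h => h.ne')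
  have := List.prod_map_pow_mul (k := k) D.x (fun i => (D.q i j : k)) m j l₁ l₂
    (fun h => lt_irrefl _ (hs'.2.2 j h j (by simp))) (fun h => lt_irrefl _ (h2.1 j h))
    (fun i _ => D.x_mul_x i j)
  rw [mono, mono, hl, this]
  congr 1
  rw [monoCoeff, ← List.prod_toFinset _ hn]
  congr 1
  ext i
  simp only [List.mem_toFinset, Finset.mem_Iio]
  refine ⟨fun h => h2.1 i h, fun h => ?_⟩
  have hi : i ∈ l₁ ++ j :: l₂ := by rw [← hl]; simp
  rcases List.mem_append.1 hi with hi | hi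
  · exact absurd (hs'.2.2 i hi j (by simp)) (not_lt_of_gt h)
  · rcases List.mem_cons.1 hi with rfl | hi
    · exact absurd h (lt_irrefl _)
    · exact hi

theorem mono_mul_x_pow (m : Fin θ → ℕ) (j : Fin θ) (t : ℕ) :
    D.mono m * D.x j ^ t = D.monoCoeff j m ^ t • D.mono (m + Pi.single j t) := by
  induction t with
  | zero => simp
  | succ t ih =>
    rw [pow_succ, ← mul_assoc, ih, smul_mul_assoc, mono_mul_x, smul_smul, monoCoeff_add_single,
      if_neg (lt_irrefl _), mul_one, add_assoc, ← Pi.single_add, pow_succ]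

theorem mono_zero : D.mono 0 = 1 := by
  simp [mono]

theorem mono_eq_zero {m : Fin θ → ℕ} {i : Fin θ} (h : D.N i ≤ m i) : D.mono m = 0 := by
  refine List.prod_eq_zero (List.mem_map.2 ⟨i, by simp, ?_⟩)
  rw [← Nat.sub_add_cancel h, pow_add, x_pow_N, mul_zero]

/-- The exponents of the standard monomials. -/
abbrev Exponent : Type := {m : Fin θ → ℕ // ∀ i, m i < D.N i}

/-- The basis vector indexed by `m`, zero if `m` is not the exponent of a standard monomial. -/
def monoVec (m : Fin θ → ℕ) : D.Exponent →₀ k :=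
  open Classical in if h : ∀ i, m i < D.N i then Finsupp.single ⟨m, h⟩ 1 else 0

theorem monoVec_eq_zero {m : Fin θ → ℕ} {i : Fin θ} (h : D.N i ≤ m i) : D.monoVec m = 0 :=
  dif_neg fun h' => absurd (h' i) (by omega)

theorem monoVec_coe (m : D.Exponent) : D.monoVec m.1 = Finsupp.single m 1 := dif_pos m.2

/-- Right multiplication by `x_j` in terms of standard monomials. -/
def rightMul (j : Fin θ) : Module.End k (D.Exponent →₀ k) :=
  Finsupp.linearCombination k fun m => D.monoCoeff j m.1 • D.monoVec (m.1 + Pi.single j 1)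

/-- No condition on `m` is needed: an exponent that is too large stays so after an increase, and
then both sides vanish. -/
theorem rightMul_monoVec (j : Fin θ) (m : Fin θ → ℕ) :
    D.rightMul j (D.monoVec m) = D.monoCoeff j m • D.monoVec (m + Pi.single j 1) := by
  by_cases h : ∀ i, m i < D.N i
  · rw [D.monoVec_coe ⟨m, h⟩]
    simp [rightMul]
  · push Not at h
    obtain ⟨i, hi⟩ := h
    rw [D.monoVec_eq_zero hi, D.monoVec_eq_zero (i := i) (by simp; omega)]
    simp

theorem rightMul_pow_monoVec (j : Fin θ) (m : Fin θ → ℕ) (t : ℕ) :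
    (D.rightMul j ^ t) (D.monoVec m) = D.monoCoeff j m ^ t • D.monoVec (m + Pi.single j t) := by
  induction t with
  | zero => simp
  | succ t ih =>
    rw [pow_succ', Module.End.mul_apply, ih, map_smul, rightMul_monoVec, smul_smul,
      monoCoeff_add_single, if_neg (lt_irrefl _), mul_one, add_assoc, ← Pi.single_add, pow_succ]

theorem hom_ext_monoVec {M : Type*} [AddCommMonoid M] [Module k M]
    {f g : (D.Exponent →₀ k) →ₗ[k] M} (h : ∀ m, f (D.monoVec m) = g (D.monoVec m)) : f = g := by
  refine Finsupp.lhom_ext' fun m => LinearMap.ext_ring ?_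
  simpa [D.monoVec_coe] using h m.1

open MulOpposite in
/-- The right action of `S` on the space of standard monomials. -/
def rightAction : D.S →ₐ[k] (Module.End k (D.Exponent →₀ k))ᵐᵒᵖ :=
  RingQuot.liftAlgHom k ⟨FreeAlgebra.lift k fun j => op (D.rightMul j), by
    intro a b h
    induction h with
    | comm i j hij =>
      simp only [map_mul, map_smul, FreeAlgebra.lift_ι_apply, ← op_mul, ← op_smul]
      congr 1
      refine D.hom_ext_monoVec fun m => ?_
      simp only [Module.End.mul_apply, LinearMap.smul_apply, rightMul_monoVec, map_smul, smul_smul,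
        monoCoeff_add_single, if_pos hij, if_neg hij.not_gt, add_right_comm m (Pi.single j 1)]
      congr 1
      ring
    | pow i =>
      simp only [map_pow, map_zero, FreeAlgebra.lift_ι_apply, ← op_pow, ← op_zero]
      congr 1
      refine D.hom_ext_monoVec fun m => ?_
      rw [rightMul_pow_monoVec, D.monoVec_eq_zero (i := i) (by simp), smul_zero,
        LinearMap.zero_apply]⟩

theorem rightAction_x (j : Fin θ) : D.rightAction (D.x j) = MulOpposite.op (D.rightMul j) := by
  simp [rightAction, x]

theorem S_induction {p : D.S → Prop} (hone : ∀ r, p (algebraMap k D.S r)) (hx : ∀ j, p (D.x j))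
    (hadd : ∀ a b, p a → p b → p (a + b)) (hmul : ∀ a b, p a → p b → p (a * b)) (s : D.S) : p s := by
  obtain ⟨a, rfl⟩ := RingQuot.mkAlgHom_surjective k D.Rel s
  induction a using FreeAlgebra.induction with
  | grade0 r => simpa using hone r
  | grade1 j => exact hx j
  | mul a b ha hb => simpa using hmul _ _ ha hb
  | add a b ha hb => simpa using hadd _ _ ha hb

/-- The linear map from the space of standard monomials to `S`. -/
def ofExponent : (D.Exponent →₀ k) →ₗ[k] D.S := Finsupp.linearCombination k fun m => D.mono m.1

theorem ofExponent_monoVec (m : Fin θ → ℕ) : D.ofExponent (D.monoVec m) = D.mono m := by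
  by_cases h : ∀ i, m i < D.N i
  · rw [D.monoVec_coe ⟨m, h⟩]
    simp [ofExponent]
  · push Not at h
    obtain ⟨i, hi⟩ := h
    rw [D.monoVec_eq_zero hi, D.mono_eq_zero hi, map_zero]

/-- The operators `rightMul` were modelled on `mono_mul_x`, so this holds on generators. At the
vector of the monomial `1` it shows that the monomials span `S`. -/
theorem ofExponent_rightAction (s : D.S) (v : D.Exponent →₀ k) :
    D.ofExponent ((D.rightAction s).unop v) = D.ofExponent v * s := by
  induction s using D.S_induction generalizing v with
  | hone r =>
    simp only [AlgHom.commutes, MulOpposite.algebraMap_apply, MulOpposite.unop_op,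
      Module.algebraMap_end_apply, map_smul]
    rw [← Algebra.commutes, Algebra.smul_def]
  | hx j =>
    have : D.ofExponent ∘ₗ D.rightMul j = LinearMap.mulRight k (D.x j) ∘ₗ D.ofExponent := by
      refine D.hom_ext_monoVec fun m => ?_
      simp [rightMul_monoVec, ofExponent_monoVec, mono_mul_x]
    simpa [rightAction_x] using LinearMap.congr_fun this v
  | hadd a b ha hb => simp [ha, hb, mul_add]
  | hmul a b ha hb => simp [ha, hb, mul_assoc]

/-- This recovers the exponent of a monomial from its action on the vector of `1`, which gives
linear independence. In the induction the scalar `monoCoeff` is nonzero and can be cancelled. -/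
theorem rightAction_mono (m : Fin θ → ℕ) :
    (D.rightAction (D.mono m)).unop (D.monoVec 0) = D.monoVec m := by
  induction m using Pi.nat_induction_single with
  | h0 => simp [mono_zero]
  | h m j ih =>
    have h := congrArg (fun s => (D.rightAction s).unop (D.monoVec 0)) (D.mono_mul_x m j)
    simp only [map_mul, map_smul, MulOpposite.unop_mul, MulOpposite.unop_smul,
      Module.End.mul_apply, LinearMap.smul_apply, ih, rightAction_x, MulOpposite.unop_op,
      rightMul_monoVec] at h
    exact (smul_right_injective _ (D.monoCoeff_ne_zero j m) h).symm

/-- The basis of `S` formed by the standard monomials. -/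
def monoBasis : Module.Basis D.Exponent k D.S :=
  .ofRepr <| LinearEquiv.symm <| LinearEquiv.ofBijective D.ofExponent <| by
    constructor
    · refine Function.LeftInverse.injective (g := fun s => (D.rightAction s).unop (D.monoVec 0)) ?_
      intro v
      induction v using Finsupp.induction_linear with
      | zero => simp
      | add v w hv hw => simp [hv, hw]
      | single m c =>
        rw [← mul_one c, ← smul_eq_mul, ← Finsupp.smul_single, ← monoVec_coe]
        simp [ofExponent_monoVec, rightAction_mono]
    · intro s
      exact ⟨(D.rightAction s).unop (D.monoVec 0), by
        rw [ofExponent_rightAction, ofExponent_monoVec, mono_zero, one_mul]⟩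

theorem monoBasis_apply (m : D.Exponent) : D.monoBasis m = D.mono m.1 := by
  simp [monoBasis, ofExponent]

/-! ### The complex `K` and its contracting homotopy -/

theorem σ_add_σ_succ (i : Fin θ) (a : ℕ) : D.σ i a + D.σ i (a + 1) = D.N i := by
  have := D.one_lt_N i
  simp only [σ, Nat.odd_add_one]
  split_ifs <;> omega

theorem σ_one (i : Fin θ) : D.σ i 1 = 1 := by simp [σ]

theorem τ_zero (i : Fin θ) : D.τ i 0 = 0 := by simp [τ]

theorem τ_succ (i : Fin θ) (a : ℕ) : D.τ i (a + 1) = D.τ i a + D.σ i (a + 1) := by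
  rw [τ, τ, Finset.sum_Icc_succ_top (by omega)]

theorem sum_add_single (a : Fin θ → ℕ) (i : Fin θ) (t : ℕ) :
    ∑ l, (a + Pi.single i t : Fin θ → ℕ) l = ∑ l, a l + t := by
  simp [Finset.sum_add_distrib]

theorem sub_add_single {a : Fin θ → ℕ} {i : Fin θ} {t : ℕ} (h : t ≤ a i) :
    a - Pi.single i t + Pi.single i t = a := by
  ext l
  obtain rfl | hl := eq_or_ne l i
  · simp only [Pi.add_apply, Pi.sub_apply, Pi.single_eq_same]; omega
  · simp [hl]

theorem sum_sub_single {a : Fin θ → ℕ} {i : Fin θ} {t : ℕ} (h : t ≤ a i) :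
    ∑ l, (a - Pi.single i t : Fin θ → ℕ) l + t = ∑ l, a l := by
  rw [← sum_add_single, sub_add_single h]

theorem Φ_of_sum_ne {n : ℕ} {a : Fin θ → ℕ} (h : ∑ i, a i ≠ n) : D.Φ n a = 0 := dif_neg h

theorem Φ_coe {n : ℕ} (a : {a : Fin θ → ℕ // ∑ i, a i = n}) : D.Φ n a.1 = Finsupp.single a 1 :=
  dif_pos a.2

theorem hom_ext_Φ {n : ℕ} {M : Type*} [AddCommMonoid M] [Module D.S M] {f g : D.K n →ₗ[D.S] M}
    (h : ∀ a, ∑ i, a i = n → f (D.Φ n a) = g (D.Φ n a)) : f = g := by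
  refine Finsupp.lhom_ext' fun a => LinearMap.ext_ring ?_
  simpa [D.Φ_coe] using h a.1 a.2

theorem dK_Φ (n : ℕ) (a : Fin θ → ℕ) :
    D.dK n (D.Φ (n + 1) a) = ∑ i, if a i = 0 then 0 else
      (D.dCoeff i a • D.x i ^ D.σ i (a i)) • D.Φ n (a - Pi.single i 1) := by
  have hu (i : Fin θ) : Function.update a i (a i - 1) = a - Pi.single i 1 := by
    ext l
    obtain rfl | hl := eq_or_ne l i <;> simp [*]
  by_cases h : ∑ i, a i = n + 1
  · rw [D.Φ_coe ⟨a, h⟩]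
    simp only [dK, Finsupp.linearCombination_single, one_smul, hu]
  · rw [Φ_of_sum_ne D h, map_zero]
    refine (Finset.sum_eq_zero fun i _ => ?_).symm
    split_ifs with hi
    · rfl
    · rw [Φ_of_sum_ne, smul_zero]
      have := sum_sub_single (t := 1) (a := a) (i := i) (by omega)
      omega

/-- The vectors `x^m Φ(a)`, which span `K_n` over `k`. -/
def monoΦ (n : ℕ) (m a : Fin θ → ℕ) : D.K n := D.mono m • D.Φ n a

theorem monoΦ_eq_zero {n : ℕ} {m a : Fin θ → ℕ} {i : Fin θ} (h : D.N i ≤ m i) :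
    D.monoΦ n m a = 0 := by rw [monoΦ, mono_eq_zero D h, zero_smul]

/-- The coefficients of the differential with respect to the vectors `x^m Φ(a)`. -/
def monoDCoeff (i : Fin θ) (m a : Fin θ → ℕ) : k := D.dCoeff i a * D.monoCoeff i m ^ D.σ i (a i)

theorem dK_monoΦ (n : ℕ) (m a : Fin θ → ℕ) :
    D.dK n (D.monoΦ (n + 1) m a) = ∑ i, if a i = 0 then 0 else
      D.monoDCoeff i m a • D.monoΦ n (m + Pi.single i (D.σ i (a i))) (a - Pi.single i 1) := by
  rw [monoΦ, map_smul, dK_Φ, Finset.smul_sum]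
  refine Finset.sum_congr rfl fun i _ => ?_
  split_ifs
  · exact smul_zero _
  · rw [smul_smul, mul_smul_comm, mono_mul_x_pow, smul_smul, monoΦ, monoDCoeff, smul_assoc]

/-- The exponent of `q_{li}` involves `m_l` and `a_l` only through `m_l + τ_l(a_l)`, the total
degree of `x^m Φ(a)` in `x_l`. This degree is invariant under the moves of `d` and of the homotopy;
only the sign `(-1)^{a_l}` changes. -/
theorem monoDCoeff_eq (i : Fin θ) (m a : Fin θ → ℕ) : D.monoDCoeff i m a =
    ∏ l ∈ Finset.Iio i, (-1) ^ a l * (D.q l i : k) ^ (D.σ i (a i) * (m l + D.τ l (a l))) := by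
  rw [monoDCoeff, dCoeff, monoCoeff, ← Finset.prod_pow, ← Finset.prod_mul_distrib]
  refine Finset.prod_congr rfl fun l _ => ?_
  rw [mul_assoc, ← pow_mul, ← pow_add]
  congr 2
  ring

/-- `i` is the least index at which `m` or `a` is nonzero. -/
def Lead (m a : Fin θ → ℕ) (i : Fin θ) : Prop :=
  (m i ≠ 0 ∨ a i ≠ 0) ∧ ∀ l < i, m l = 0 ∧ a l = 0

theorem Lead.unique {m a : Fin θ → ℕ} {i j : Fin θ} (hi : Lead m a i) (hj : Lead m a j) :
    i = j := by
  by_contra h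
  rcases lt_or_gt_of_ne h with h | h
  · have := hj.2 i h; have := hi.1; omega
  · have := hi.2 j h; have := hj.1; omega

theorem exists_lead {m a : Fin θ → ℕ} {j : Fin θ} (h : m j ≠ 0 ∨ a j ≠ 0) : ∃ i, Lead m a i := by
  classical
  have hne : (Finset.univ.filter fun i => m i ≠ 0 ∨ a i ≠ 0).Nonempty := ⟨j, by simp [h]⟩
  refine ⟨Finset.min' _ hne, by simpa using Finset.min'_mem _ hne, fun l hl => ?_⟩
  by_contra hc
  exact absurd (Finset.min'_le _ l (by simp; tauto)) (not_le_of_gt hl)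

theorem Lead.le {m a : Fin θ → ℕ} {i j : Fin θ} (h : Lead m a i) (hj : a j ≠ 0) : i ≤ j := by
  by_contra hc
  exact hj (h.2 j (not_le.1 hc)).2

theorem Lead.move {m a : Fin θ → ℕ} {i j : Fin θ} (h : Lead m a i) (hj : a j ≠ 0) {t : ℕ}
    (ht : t ≠ 0) : Lead (m + Pi.single j t) (a - Pi.single j 1) i := by
  have hij := h.le hj
  refine ⟨?_, fun l hl => ?_⟩
  · obtain rfl | hne := eq_or_ne i j
    · left; simp [ht]
    · simpa [hne] using h.1
  · have : l ≠ j := by rintro rfl; exact absurd hl (not_lt_of_ge hij)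
    simpa [this] using h.2 l hl

theorem monoDCoeff_of_lead {m a : Fin θ → ℕ} {i : Fin θ} (h : ∀ l < i, m l = 0 ∧ a l = 0) :
    D.monoDCoeff i m a = 1 := by
  rw [monoDCoeff_eq]
  refine Finset.prod_eq_one fun l hl => ?_
  obtain ⟨h1, h2⟩ := h l (by simpa using hl)
  simp [h1, h2, τ_zero]

/-- The move at `i` preserves the total degree in `x_i` and raises `a_i` by one, so the factor `l =
i` changes sign and the others are unchanged. -/
theorem monoDCoeff_move {m a : Fin θ → ℕ} {i j : Fin θ} (hij : i < j)
    (h : D.σ i (a i + 1) ≤ m i) :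
    D.monoDCoeff j (m - Pi.single i (D.σ i (a i + 1))) (a + Pi.single i 1) =
      -D.monoDCoeff j m a := by
  simp only [monoDCoeff_eq]
  rw [← Finset.mul_prod_erase _ _ (Finset.mem_Iio.2 hij),
    ← Finset.mul_prod_erase (Finset.Iio j) (fun l => (-1) ^ a l * _) (Finset.mem_Iio.2 hij),
    ← neg_mul]
  congr 1
  · have e : m i - D.σ i (a i + 1) + D.τ i (a i + 1) = m i + D.τ i (a i) := by
      rw [τ_succ]; omega
    simp [hij.ne', e, pow_succ]
  · refine Finset.prod_congr rfl fun l hl => ?_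
    simp [Finset.ne_of_mem_erase hl, hij.ne']

open Classical in
/-- The contracting homotopy on `x^m Φ(a)`. -/
def contract (n : ℕ) (m a : Fin θ → ℕ) : D.K n :=
  ∑ i, if Lead m a i ∧ (∀ l, m l < D.N l) ∧ D.σ i (a i + 1) ≤ m i then
    D.monoΦ n (m - Pi.single i (D.σ i (a i + 1))) (a + Pi.single i 1) else 0

theorem contract_of_lead {n : ℕ} {m a : Fin θ → ℕ} {i : Fin θ} (h : Lead m a i)
    (hm : ∀ l, m l < D.N l) (hi : D.σ i (a i + 1) ≤ m i) :
    D.contract n m a = D.monoΦ n (m - Pi.single i (D.σ i (a i + 1))) (a + Pi.single i 1) := by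
  rw [contract, Finset.sum_eq_single_of_mem i (Finset.mem_univ i) fun j _ hj =>
    if_neg fun hc => hj (hc.1.unique h), if_pos ⟨h, hm, hi⟩]

theorem contract_eq_zero {n : ℕ} {m a : Fin θ → ℕ} {i : Fin θ} (h : Lead m a i)
    (hi : m i < D.σ i (a i + 1)) : D.contract n m a = 0 := by
  refine Finset.sum_eq_zero fun j _ => if_neg fun hc => ?_
  obtain rfl := hc.1.unique h
  omega

theorem contract_of_le {n : ℕ} {m a : Fin θ → ℕ} {i : Fin θ} (h : D.N i ≤ m i) :
    D.contract n m a = 0 :=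
  Finset.sum_eq_zero fun _ _ => if_neg fun hc => absurd (hc.2.1 i) (not_lt_of_ge h)

/-- Let `i` be the leading index. Since `σ_i(a_i) + σ_i(a_i+1) = N_i`, exactly one of the two
summands has a nonzero `i`-term, and that term is `x^m Φ(a)`. The `j`-terms with `j > i` cancel by
`monoDCoeff_move`, or vanish. -/
theorem dK_contract {n : ℕ} {m a : Fin θ → ℕ} {i : Fin θ} (h : Lead m a i)
    (hm : ∀ l, m l < D.N l) :
    D.dK n (D.contract (n + 1) m a) + ∑ j, (if a j = 0 then 0 else
      D.monoDCoeff j m a • D.contract n (m + Pi.single j (D.σ j (a j))) (a - Pi.single j 1)) =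
      D.monoΦ n m a := by
  have hN (b : ℕ) := D.σ_add_σ_succ i b
  by_cases hi : D.σ i (a i + 1) ≤ m i
  · rw [contract_of_lead D h hm hi, dK_monoΦ, ← Finset.sum_add_distrib,
      Finset.sum_eq_single_of_mem i (Finset.mem_univ i)]
    · rw [if_neg (by simp), monoDCoeff_of_lead, one_smul]
      · have e₁ : m - Pi.single i (D.σ i (a i + 1)) +
            Pi.single i (D.σ i ((a + Pi.single i 1 : Fin θ → ℕ) i)) = m := by
          simpa using sub_add_single hi
        rw [e₁, add_tsub_cancel_right, add_eq_left]
        split_ifs with ha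
        · rfl
        -- Here `m_i + σ_i(a_i) ≥ σ_i(a_i+1) + σ_i(a_i) = N_i`, so `d_i` already kills the vector.
        · rw [contract_of_le D (i := i), smul_zero]
          have := hN (a i)
          simp; omega
      · intro l hl
        simpa [hl.ne] using h.2 l hl
    · intro j _ hj
      have e : (a + Pi.single i 1 : Fin θ → ℕ) j = a j := by simp [hj]
      rw [e]
      split_ifs with ha
      · simp
      · have hij : i < j := lt_of_le_of_ne (h.le ha) hj.symm
        have e₁ : m - Pi.single i (D.σ i (a i + 1)) + Pi.single j (D.σ j (a j)) =
            m + Pi.single j (D.σ j (a j)) - Pi.single i (D.σ i (a i + 1)) := by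
          ext l
          obtain rfl | hl := eq_or_ne l i
          · simp [hj.symm]
          · simp [hl]
        have e₂ : a + Pi.single i 1 - Pi.single j 1 = a - Pi.single j 1 + Pi.single i 1 := by
          ext l
          obtain rfl | hl := eq_or_ne l i
          · simp [hj.symm]
          · simp [hl]
        rw [monoDCoeff_move D hij hi, e₁, e₂]
        by_cases hb : ∀ l, (m + Pi.single j (D.σ j (a j)) : Fin θ → ℕ) l < D.N l
        · have e₃ : (a - Pi.single j 1 : Fin θ → ℕ) i = a i := by simp [hj.symm]
          rw [contract_of_lead D (h.move ha (D.σ_pos j _)) hb (by simpa [e₃, hj.symm] using hi), e₃,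
            ← add_smul, neg_add_cancel, zero_smul]
        -- The exponent of `x_j` has reached `N_j`, so both `j`-terms are zero.
        · push Not at hb
          obtain ⟨l, hl⟩ := hb
          have hl' : l = j := by
            by_contra hc
            have := hm l
            simp [hc] at hl
            omega
          subst hl'
          rw [contract_of_le D hl, monoΦ_eq_zero D (i := l) (by simpa [hj] using hl), smul_zero,
            smul_zero, add_zero]
  · push Not at hi
    -- If `a_i = 0`, then `m_i < σ_i(1) = 1`, so both entries at the leading index would vanish.
    have ha : a i ≠ 0 := by
      intro ha
      have := h.1
      rw [ha, zero_add, σ_one] at hi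
      omega
    rw [contract_eq_zero D h hi, map_zero, zero_add,
      Finset.sum_eq_single_of_mem i (Finset.mem_univ i)]
    · have e : (a - Pi.single i 1 : Fin θ → ℕ) i + 1 = a i := by simp; omega
      rw [if_neg ha, monoDCoeff_of_lead D h.2, one_smul,
        contract_of_lead D (h.move ha (D.σ_pos i _)), e, add_tsub_cancel_right,
        sub_add_single (by omega)]
      · intro l
        obtain rfl | hl := eq_or_ne l i
        · have := hN (a l)
          simp; omega
        · simpa [hl] using hm l
      · rw [e]; simp
    · intro j _ hj
      split_ifs with hja
      · rfl
      · rw [contract_eq_zero D (h.move hja (D.σ_pos j _)) (by simpa [hj.symm] using hi), smul_zero]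

/-- The basis of `K_n` over `k` formed by the vectors `x^m Φ(a)`. -/
def basisK (n : ℕ) :
    Module.Basis (Σ _ : {a : Fin θ → ℕ // ∑ i, a i = n}, D.Exponent) k (D.K n) :=
  Finsupp.basis fun _ => D.monoBasis

theorem basisK_apply {n : ℕ} (p) : D.basisK n p = D.monoΦ n p.2.1 p.1.1 := by
  rw [monoΦ, Φ_coe, Finsupp.smul_single, smul_eq_mul, mul_one, ← monoBasis_apply]
  simp [basisK, Finsupp.coe_basis]

/-- The contracting homotopy of the complex `K`. -/
def homotopyK (n : ℕ) : D.K n →ₗ[k] D.K (n + 1) :=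
  (D.basisK n).constr k fun p => D.contract (n + 1) p.2.1 p.1.1

theorem homotopyK_monoΦ {n : ℕ} (m a : Fin θ → ℕ) (ha : ∑ i, a i = n) :
    D.homotopyK n (D.monoΦ n m a) = D.contract (n + 1) m a := by
  by_cases h : ∀ i, m i < D.N i
  · rw [← D.basisK_apply ⟨⟨a, ha⟩, ⟨m, h⟩⟩, homotopyK, Module.Basis.constr_basis]
  · push Not at h
    obtain ⟨i, hi⟩ := h
    rw [monoΦ_eq_zero D hi, map_zero, contract_of_le D hi]

theorem dK_homotopyK_succ (n : ℕ) (y : D.K (n + 1)) :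
    D.dK (n + 1) (D.homotopyK (n + 1) y) + D.homotopyK n (D.dK n y) = y := by
  suffices (D.dK (n + 1)).restrictScalars k ∘ₗ D.homotopyK (n + 1) +
      D.homotopyK n ∘ₗ (D.dK n).restrictScalars k = LinearMap.id from LinearMap.congr_fun this y
  refine (D.basisK (n + 1)).ext fun ⟨⟨a, ha⟩, ⟨m, hm⟩⟩ => ?_
  -- In positive degree `a` is nonzero, so there is a leading index.
  obtain ⟨j, hj⟩ : ∃ j, a j ≠ 0 := by
    by_contra! hc
    simp [hc] at ha
  obtain ⟨i, hi⟩ := exists_lead (m := m) (Or.inr hj)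
  rw [basisK_apply]
  simp only [LinearMap.add_apply, LinearMap.comp_apply, LinearMap.restrictScalars_apply,
    LinearMap.id_apply, homotopyK_monoΦ D m a ha]
  conv_rhs => rw [← dK_contract D hi hm]
  rw [dK_monoΦ, map_sum]
  refine congrArg _ (Finset.sum_congr rfl fun l _ => ?_)
  split_ifs with hl
  · exact map_zero _
  · rw [map_smul, homotopyK_monoΦ]
    have := sum_sub_single (t := 1) (a := a) (i := l) (by omega)
    omega

theorem ε_mono (m : Fin θ → ℕ) : D.ε (D.mono m) = if m = 0 then 1 else 0 := by
  split_ifs with h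
  · rw [h, mono_zero, map_one]
  · obtain ⟨i, hi⟩ := Function.ne_iff.1 h
    rw [mono, map_list_prod]
    refine List.prod_eq_zero (List.mem_map.2 ⟨D.x i ^ m i, List.mem_map.2 ⟨i, by simp, rfl⟩, ?_⟩)
    rw [map_pow, ε_x, zero_pow hi]

theorem dual_single {n : ℕ} (b : Fin θ → ℕ) (a : {a : Fin θ → ℕ // ∑ i, a i = n}) (s : D.S) :
    D.dual n b (Finsupp.single a s) = (if a.1 = b then D.ε s else 0 : k) := by
  rw [dual, Finsupp.linearCombination_single, smul_triv]
  change D.ε s * (if a.1 = b then (1 : k) else 0) = _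
  split_ifs <;> simp

theorem dK_homotopyK_zero (y : D.K 0) :
    D.dK 0 (D.homotopyK 0 y) + (show k from D.augK y) • D.Φ 0 0 = y := by
  let f : D.K 0 →ₗ[k] k :=
    { toFun := fun y => D.augK y
      map_add' := fun y z => map_add D.augK y z
      map_smul' := fun r y => by
        rw [← algebraMap_smul D.S r y, map_smul, smul_triv]
        change D.ε (algebraMap k D.S r) * _ = r * _
        rw [AlgHom.commutes]
        rfl }
  suffices (D.dK 0).restrictScalars k ∘ₗ D.homotopyK 0 +
      f.smulRight (D.Φ 0 0) = LinearMap.id from LinearMap.congr_fun this y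
  refine (D.basisK 0).ext fun ⟨⟨a, ha⟩, ⟨m, hm⟩⟩ => ?_
  obtain rfl : a = 0 := by
    ext i
    exact (Finset.sum_eq_zero_iff.1 ha) i (Finset.mem_univ i)
  rw [basisK_apply]
  have hf : f (D.monoΦ 0 m 0) = if m = 0 then 1 else 0 := by
    rw [monoΦ, D.Φ_coe ⟨0, ha⟩, Finsupp.smul_single, smul_eq_mul, mul_one]
    change D.dual 0 0 _ = _
    rw [dual_single, if_pos rfl, ε_mono]
  simp only [LinearMap.add_apply, LinearMap.comp_apply, LinearMap.restrictScalars_apply,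
    LinearMap.id_apply, homotopyK_monoΦ D m 0 ha, LinearMap.smulRight_apply, hf]
  by_cases h : m = 0
  · subst h
    rw [if_pos rfl, one_smul, monoΦ, mono_zero, one_smul, add_eq_right]
    -- The vector `Φ(0)` alone has no leading index; the augmentation term accounts for it.
    have : D.contract (0 + 1) (0 : Fin θ → ℕ) 0 = 0 :=
      Finset.sum_eq_zero fun i _ => if_neg fun hc => by simpa using hc.1.1
    rw [this, map_zero]
  · obtain ⟨j, hj⟩ := Function.ne_iff.1 h
    obtain ⟨i, hi⟩ := exists_lead (m := m) (a := 0) (Or.inl hj)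
    rw [if_neg h, zero_smul, add_zero]
    simpa using dK_contract D (n := 0) hi hm

/-- The terms of `d d` are indexed by pairs `(i, j)`. Those for `(i, j)` and `(j, i)` cancel by
`monoDCoeff_move`, and the diagonal ones contain `x_i^{N_i} = 0`. -/
theorem dK_comp_dK (n : ℕ) : D.dK n ∘ₗ D.dK (n + 1) = 0 := by
  refine D.hom_ext_Φ fun a _ => ?_
  have e (a) : D.Φ (n + 1 + 1) a = D.monoΦ (n + 1 + 1) 0 a := by rw [monoΦ, mono_zero, one_smul]
  rw [e, LinearMap.comp_apply, LinearMap.zero_apply]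
  generalize (0 : Fin θ → ℕ) = m
  rw [dK_monoΦ, map_sum]
  let F (i j : Fin θ) : D.K n := if a i ≠ 0 ∧ (a - Pi.single i 1 : Fin θ → ℕ) j ≠ 0 then
    (D.monoDCoeff i m a *
      D.monoDCoeff j (m + Pi.single i (D.σ i (a i))) (a - Pi.single i 1)) •
        D.monoΦ n (m + Pi.single i (D.σ i (a i)) +
          Pi.single j (D.σ j ((a - Pi.single i 1 : Fin θ → ℕ) j)))
            (a - Pi.single i 1 - Pi.single j 1) else 0
  have hF (i : Fin θ) : D.dK n (if a i = 0 then 0 else D.monoDCoeff i m a •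
      D.monoΦ (n + 1) (m + Pi.single i (D.σ i (a i))) (a - Pi.single i 1)) = ∑ j, F i j := by
    by_cases hi : a i = 0
    · simp [F, hi]
    · rw [if_neg hi, ← algebraMap_smul D.S, map_smul, algebraMap_smul, dK_monoΦ, Finset.smul_sum]
      refine Finset.sum_congr rfl fun j _ => ?_
      by_cases hj : (a - Pi.single i 1 : Fin θ → ℕ) j = 0
      · rw [if_pos hj, smul_zero]
        exact (if_neg fun h => h.2 hj).symm
      · rw [if_neg hj, smul_smul]
        exact (if_pos ⟨hi, hj⟩).symm
  have hlt (i j : Fin θ) (hij : i < j) : F i j + F j i = 0 := by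
    have h1 : (a - Pi.single i 1 : Fin θ → ℕ) j = a j := by simp [hij.ne']
    have h2 : (a - Pi.single j 1 : Fin θ → ℕ) i = a i := by simp [hij.ne]
    simp only [F, h1, h2]
    by_cases h : a i ≠ 0 ∧ a j ≠ 0
    · rw [if_pos h, if_pos h.symm, add_right_comm m, tsub_right_comm (a := a), ← add_smul]
      have h3 : D.monoDCoeff i (m + Pi.single j (D.σ j (a j))) (a - Pi.single j 1) =
          D.monoDCoeff i m a := by
        simp only [monoDCoeff_eq, h2]
        refine Finset.prod_congr rfl fun l hl => ?_
        have : l ≠ j := ((Finset.mem_Iio.1 hl).trans hij).ne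
        simp [this]
      have h4 := D.monoDCoeff_move (m := m + Pi.single i (D.σ i (a i))) (a := a - Pi.single i 1)
        hij
      have h5 : (a - Pi.single i 1 : Fin θ → ℕ) i + 1 = a i := by simp; omega
      rw [h5, add_tsub_cancel_right, sub_add_single (by omega)] at h4
      rw [h3, h4 (by simp), neg_mul, mul_comm, add_neg_cancel, zero_smul]
    · rw [if_neg h, if_neg fun h' => h h'.symm, add_zero]
  have hii (i : Fin θ) : F i i = 0 := by
    by_cases h : a i ≠ 0 ∧ (a - Pi.single i 1 : Fin θ → ℕ) i ≠ 0
    · have h5 : (a - Pi.single i 1 : Fin θ → ℕ) i + 1 = a i := by simp; omega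
      have h6 := D.σ_add_σ_succ i ((a - Pi.single i 1 : Fin θ → ℕ) i)
      rw [h5] at h6
      refine (if_pos h).trans ?_
      rw [monoΦ_eq_zero D (i := i), smul_zero]
      simp only [Pi.add_apply, Pi.single_eq_same]
      omega
    · exact if_neg h
  rw [Finset.sum_congr rfl fun i _ => hF i, ← Finset.sum_product']
  refine Finset.sum_involution (fun p _ => p.swap) ?_ ?_ ?_ ?_
  · rintro ⟨i, j⟩ _
    obtain h | rfl | h := lt_trichotomy i j
    · exact hlt i j h
    · simp [hii]
    · exact (add_comm _ _).trans (hlt j i h)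
  · rintro ⟨i, j⟩ _ h h'
    obtain rfl : j = i := congrArg Prod.fst h'
    exact h (hii j)
  · simp
  · simp

theorem augK_comp_dK : D.augK ∘ₗ D.dK 0 = 0 := D.dual_dK 0 0

theorem exact_dK (n : ℕ) : Function.Exact (D.dK (n + 1)) (D.dK n) := by
  refine fun y => ⟨fun h => ⟨D.homotopyK (n + 1) y, ?_⟩, ?_⟩
  · simpa [h] using D.dK_homotopyK_succ n y
  · rintro ⟨y, rfl⟩
    exact LinearMap.congr_fun (D.dK_comp_dK n) y

theorem exact_augK : Function.Exact (D.dK 0) D.augK := by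
  refine fun y => ⟨fun h => ⟨D.homotopyK 0 y, ?_⟩, ?_⟩
  · have := D.dK_homotopyK_zero y
    rw [h] at this
    rwa [show (show k from (0 : D.Triv)) = (0 : k) from rfl, zero_smul, add_zero] at this
  · rintro ⟨y, rfl⟩
    exact LinearMap.congr_fun D.augK_comp_dK y

theorem augK_surjective : Function.Surjective D.augK := by
  intro c
  refine ⟨Finsupp.single ⟨0, by simp⟩ (algebraMap k D.S c), ?_⟩
  rw [augK, dual_single, if_pos rfl]
  exact D.ε.commutes c

/-! ### `K` as a projective resolution of `k` -/

/-- The complex `K` as a complex of `S`-modules. -/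
def complexK : ChainComplex (ModuleCat.{u} D.S) ℕ :=
  ChainComplex.of (fun n => ModuleCat.of D.S (D.K n)) (fun n => ModuleCat.ofHom (D.dK n))
    (fun n => by rw [← ModuleCat.ofHom_comp, dK_comp_dK]; rfl)

theorem complexK_d (n : ℕ) : D.complexK.d (n + 1) n = ModuleCat.ofHom (D.dK n) :=
  by simp [complexK, ChainComplex.of]

/-- The short complex `K_1 → K_0 → k`. -/
def augShortComplex : ShortComplex (ModuleCat.{u} D.S) where
  X₁ := ModuleCat.of D.S (D.K 1)
  X₂ := ModuleCat.of D.S (D.K 0)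
  X₃ := D.triv
  f := ModuleCat.ofHom (D.dK 0)
  g := ModuleCat.ofHom D.augK
  zero := (ModuleCat.ofHom_comp _ _).symm.trans (by rw [augK_comp_dK]; rfl)

/-- The complex `K` is a projective resolution of the trivial module. -/
def resolutionK : ProjectiveResolution D.triv where
  complex := D.complexK
  projective n := (inferInstance : Projective (ModuleCat.of D.S (D.K n)))
  π := (ChainComplex.toSingle₀Equiv _ _).symm ⟨ModuleCat.ofHom D.augK, by
    rw [complexK_d]
    exact (ModuleCat.ofHom_comp _ _).symm.trans (by rw [augK_comp_dK]; rfl)⟩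
  quasiIso := ⟨fun n => by
    cases n with
    | zero =>
      rw [ChainComplex.quasiIsoAt₀_iff, ShortComplex.quasiIso_iff_of_zeros']
      · refine (ShortComplex.exact_and_epi_g_iff_of_iso (S₂ := D.augShortComplex) ?_).2
          ⟨(ShortComplex.ShortExact.moduleCat_exact_iff_function_exact _).2 D.exact_augK,
            (ModuleCat.epi_iff_surjective _).2 D.augK_surjective⟩
        exact ShortComplex.isoMk (Iso.refl _) (Iso.refl _) (Iso.refl _)
          (by
            refine (Category.id_comp _).trans (Eq.trans ?_ (Category.comp_id _).symm)
            exact (D.complexK_d 0).symm)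
          (by
            refine (Category.id_comp _).trans (Eq.trans ?_ (Category.comp_id _).symm)
            exact (ChainComplex.toSingle₀Equiv_symm_apply_f_zero (C := D.complexK) (X := D.triv)
              (ModuleCat.ofHom D.augK) _).symm)
      all_goals rfl
    | succ n =>
      rw [quasiIsoAt_iff_exactAt']
      · rw [HomologicalComplex.exactAt_iff' _ (n + 1 + 1) (n + 1) n (by simp) (by simp)]
        refine (ShortComplex.ShortExact.moduleCat_exact_iff_function_exact _).2 ?_
        change Function.Exact (D.complexK.d (n + 1 + 1) (n + 1)).hom (D.complexK.d (n + 1) n).hom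
        rw [complexK_d, complexK_d]
        exact D.exact_dK n
      · apply ChainComplex.exactAt_succ_single_obj⟩

theorem nonempty_resolution : Nonempty D.Resolution :=
  ⟨{ res := D.resolutionK
     iso := fun n => Iso.refl _
     d_iso := fun n => by
       change D.complexK.d (n + 1) n ≫ 𝟙 _ = 𝟙 _ ≫ _
       rw [complexK_d]
       exact (Category.comp_id _).trans (Category.id_comp _).symm
     π_iso := by
       refine (ChainComplex.toSingle₀Equiv_symm_apply_f_zero _ _).trans ?_
       exact ((Category.id_comp _).trans (Category.comp_id _)).symm }⟩

/-! ### Chain maps on `K` that lift `ξ_i` and `η_i` -/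

theorem prod_add_single (s : Finset (Fin θ)) (F : Fin θ → ℕ → k) (a : Fin θ → ℕ) (j : Fin θ)
    (r : k) (hr : F j (a j + 1) = F j (a j) * r) :
    ∏ l ∈ s, F l ((a + Pi.single j 1 : Fin θ → ℕ) l) =
      (∏ l ∈ s, F l (a l)) * if j ∈ s then r else 1 := by
  split_ifs with h
  · have he : ∏ l ∈ s.erase j, F l ((a + Pi.single j 1 : Fin θ → ℕ) l) =
        ∏ l ∈ s.erase j, F l (a l) :=
      Finset.prod_congr rfl fun l hl => by simp [Finset.ne_of_mem_erase hl]
    rw [← Finset.mul_prod_erase s _ h, ← Finset.mul_prod_erase s (fun l => F l (a l)) h, he]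
    simp only [Pi.add_apply, Pi.single_eq_same]
    rw [hr, mul_right_comm]
  · rw [mul_one]
    refine Finset.prod_congr rfl fun l hl => ?_
    simp [show l ≠ j by rintro rfl; exact h hl]

/-- The scalar `∏_{l < i} (-1)^{a_l} q_{li}^{s τ_l(a_l)}`. -/
def signedCoeff (i : Fin θ) (s : ℕ) (a : Fin θ → ℕ) : k :=
  ∏ l ∈ Finset.Iio i, (-1) ^ a l * (D.q l i : k) ^ (s * D.τ l (a l))

/-- The scalar `∏_{l < i} q_{li}^{s τ_l(a_l)}`. -/
def lowerCoeff (i : Fin θ) (s : ℕ) (a : Fin θ → ℕ) : k :=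
  ∏ l ∈ Finset.Iio i, (D.q l i : k) ^ (s * D.τ l (a l))

/-- The scalar `∏_{l > i} (-1)^{a_l} q_{il}^{τ_l(a_l)}`. -/
def upperCoeff (i : Fin θ) (a : Fin θ → ℕ) : k :=
  ∏ l ∈ Finset.Ioi i, (-1) ^ a l * (D.q i l : k) ^ D.τ l (a l)

/-- The coefficient of the chain map that lifts `ξ_i`. -/
def ξCoeff (i : Fin θ) (a : Fin θ → ℕ) : k :=
  ∏ l ∈ Finset.Ioi i, (D.q i l : k) ^ (D.N i * D.τ l (a l))

/-- The coefficient of the chain map that lifts `η_i`. -/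
def ηCoeff (i : Fin θ) (a : Fin θ → ℕ) : k :=
  D.upperCoeff i a * D.lowerCoeff i (D.σ i (a i) - 1) a

theorem dCoeff_eq (i : Fin θ) (a : Fin θ → ℕ) :
    D.dCoeff i a = D.signedCoeff i (D.σ i (a i)) a := rfl

theorem signedCoeff_add_single (i j : Fin θ) (s : ℕ) (a : Fin θ → ℕ) :
    D.signedCoeff i s (a + Pi.single j 1) = D.signedCoeff i s a *
      if j < i then -(D.q j i : k) ^ (s * D.σ j (a j + 1)) else 1 := by
  exact (prod_add_single (Finset.Iio i)
    (fun l b => (-1) ^ b * (D.q l i : k) ^ (s * D.τ l b)) a j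
    (-(D.q j i : k) ^ (s * D.σ j (a j + 1))) (by rw [τ_succ]; ring)).trans
      (by simp only [Finset.mem_Iio]; rfl)

theorem lowerCoeff_add_single (i j : Fin θ) (s : ℕ) (a : Fin θ → ℕ) :
    D.lowerCoeff i s (a + Pi.single j 1) = D.lowerCoeff i s a *
      if j < i then (D.q j i : k) ^ (s * D.σ j (a j + 1)) else 1 := by
  exact (prod_add_single (Finset.Iio i)
    (fun l b => (D.q l i : k) ^ (s * D.τ l b)) a j
    ((D.q j i : k) ^ (s * D.σ j (a j + 1))) (by rw [τ_succ]; ring)).trans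
      (by simp only [Finset.mem_Iio]; rfl)

theorem upperCoeff_add_single (i j : Fin θ) (a : Fin θ → ℕ) :
    D.upperCoeff i (a + Pi.single j 1) = D.upperCoeff i a *
      if i < j then -(D.q i j : k) ^ (D.σ j (a j + 1)) else 1 := by
  exact (prod_add_single (Finset.Ioi i)
    (fun l b => (-1) ^ b * (D.q i l : k) ^ (D.τ l b)) a j
    (-(D.q i j : k) ^ (D.σ j (a j + 1))) (by rw [τ_succ]; ring)).trans
      (by simp only [Finset.mem_Ioi]; rfl)

theorem ξCoeff_add_single (i j : Fin θ) (a : Fin θ → ℕ) :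
    D.ξCoeff i (a + Pi.single j 1) = D.ξCoeff i a *
      if i < j then (D.q i j : k) ^ (D.N i * D.σ j (a j + 1)) else 1 := by
  exact (prod_add_single (Finset.Ioi i)
    (fun l b => (D.q i l : k) ^ (D.N i * D.τ l b)) a j
    ((D.q i j : k) ^ (D.N i * D.σ j (a j + 1))) (by rw [τ_succ]; ring)).trans
      (by simp only [Finset.mem_Ioi]; rfl)

theorem signedCoeff_eq (i : Fin θ) (s : ℕ) (a : Fin θ → ℕ) :
    D.signedCoeff i s a = (∏ l ∈ Finset.Iio i, (-1) ^ a l) * D.lowerCoeff i s a := by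
  rw [signedCoeff, Finset.prod_mul_distrib, lowerCoeff]

theorem lowerCoeff_mul (i : Fin θ) (s t : ℕ) (a : Fin θ → ℕ) :
    D.lowerCoeff i s a * D.lowerCoeff i t a = D.lowerCoeff i (s + t) a := by
  simp only [lowerCoeff, ← Finset.prod_mul_distrib, ← pow_add, add_mul]

theorem σ_sub_one_add (i : Fin θ) (a : ℕ) : D.σ i a - 1 + 1 = D.σ i a :=
  Nat.sub_add_cancel (Nat.pos_of_ne_zero (D.σ_pos i a))

/-- The `j`-terms of `d` after the lift and of the lift after `d` agree one by one. For `i = j` this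
is additivity of `lowerCoeff` in the exponent. For `i ≠ j` the powers of `x_i` and `x_j` have to be
interchanged. -/
theorem ηCoeff_comm (i j : Fin θ) (b : Fin θ → ℕ) :
    (D.ηCoeff i (b + Pi.single j 1 + Pi.single i 1) * D.dCoeff j (b + Pi.single j 1)) •
      (D.x i ^ (D.σ i ((b + Pi.single j 1 + Pi.single i 1 : Fin θ → ℕ) i) - 1) *
        D.x j ^ D.σ j ((b + Pi.single j 1 : Fin θ → ℕ) j)) =
    (D.dCoeff j (b + Pi.single j 1 + Pi.single i 1) * D.ηCoeff i (b + Pi.single i 1)) •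
      (D.x j ^ D.σ j ((b + Pi.single j 1 + Pi.single i 1 : Fin θ → ℕ) j) *
        D.x i ^ (D.σ i ((b + Pi.single i 1 : Fin θ → ℕ) i) - 1)) := by
  simp only [dCoeff_eq, ηCoeff, add_right_comm b (Pi.single j 1)]
  obtain rfl | hij := eq_or_ne i j
  · simp only [Pi.add_apply, Pi.single_eq_same, upperCoeff_add_single, lowerCoeff_add_single,
      signedCoeff_add_single, lt_irrefl, if_false, mul_one]
    simp only [signedCoeff_eq, ← pow_add]
    have h1 := D.σ_sub_one_add i (b i + 1)
    have h2 := D.σ_sub_one_add i (b i + 1 + 1)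
    rw [show D.σ i (b i + 1 + 1) - 1 + D.σ i (b i + 1) =
      D.σ i (b i + 1 + 1) + (D.σ i (b i + 1) - 1) by omega]
    congr 1
    have h3 := D.lowerCoeff_mul i (D.σ i (b i + 1 + 1) - 1) (D.σ i (b i + 1)) b
    rw [show D.σ i (b i + 1 + 1) - 1 + D.σ i (b i + 1) =
      D.σ i (b i + 1 + 1) + (D.σ i (b i + 1) - 1) by omega, ← lowerCoeff_mul] at h3
    linear_combination (D.upperCoeff i b * ∏ l ∈ Finset.Iio i, (-1) ^ b l) * h3
  · have e₁ : (b + Pi.single i 1 + Pi.single j 1 : Fin θ → ℕ) i = b i + 1 := by simp [hij]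
    have e₂ : (b + Pi.single i 1 + Pi.single j 1 : Fin θ → ℕ) j = b j + 1 := by simp [hij.symm]
    have e₃ : (b + Pi.single i 1 : Fin θ → ℕ) j = b j := by simp [hij.symm]
    have e₄ : (b + Pi.single j 1 : Fin θ → ℕ) j = b j + 1 := by simp
    have e₅ : (b + Pi.single i 1 : Fin θ → ℕ) i = b i + 1 := by simp
    simp only [e₁, e₂, e₃, e₄, e₅, upperCoeff_add_single, lowerCoeff_add_single,
      signedCoeff_add_single, lt_irrefl, if_false, mul_one]
    rw [x_pow_mul_x_pow, smul_smul]
    congr 1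
    obtain h | h := lt_or_gt_of_ne hij
    · simp only [h, h.not_gt, if_true, if_false, mul_one]
      have h1 := D.σ_sub_one_add i (b i + 1)
      generalize D.σ i (b i + 1) - 1 = s at *
      rw [← h1]
      ring
    · simp only [h, h.not_gt, if_true, if_false, mul_one]
      -- For `j < i` the scalar from interchanging the powers of `x_i` and `x_j` cancels the factor
      -- `l = j` of `lowerCoeff`.
      have h1 : (D.q j i : k) ^ ((D.σ i (b i + 1) - 1) * D.σ j (b j + 1)) *
          (D.q i j : k) ^ ((D.σ i (b i + 1) - 1) * D.σ j (b j + 1)) = 1 := by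
        rw [← mul_pow, q_mul_q, one_pow]
      linear_combination (D.upperCoeff i b * D.lowerCoeff i (D.σ i (b i + 1) - 1) b *
        D.signedCoeff j (D.σ j (b j + 1)) b) * h1

/-- Two steps at `i` raise `τ_i` by `N_i`, which is the exponent built into `ξCoeff`. Their two
signs cancel, and no power of `x_i` is needed because `σ_i` has period `2`. -/
theorem ξCoeff_comm (i j : Fin θ) (b : Fin θ → ℕ) :
    (D.ξCoeff i (b + Pi.single j 1 + Pi.single i 2) * D.dCoeff j (b + Pi.single j 1)) •
        D.x j ^ D.σ j ((b + Pi.single j 1 : Fin θ → ℕ) j) =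
    (D.dCoeff j (b + Pi.single j 1 + Pi.single i 2) * D.ξCoeff i (b + Pi.single i 2)) •
        D.x j ^ D.σ j ((b + Pi.single j 1 + Pi.single i 2 : Fin θ → ℕ) j) := by
  have hσ (c : ℕ) : D.σ j (c + 2) = D.σ j c := by simp [σ, Nat.odd_add, parity_simps]
  have h2 : (Pi.single i 2 : Fin θ → ℕ) = Pi.single i 1 + Pi.single i 1 := by
    rw [← Pi.single_add]
  have e₁ : D.σ j ((b + Pi.single j 1 + Pi.single i 2 : Fin θ → ℕ) j) = D.σ j (b j + 1) := by
    obtain rfl | hij := eq_or_ne i j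
    · simp [hσ]
    · simp [hij.symm]
  have e₂ : (b + Pi.single j 1 : Fin θ → ℕ) j = b j + 1 := by simp
  rw [dCoeff_eq, dCoeff_eq, e₁, e₂, h2]
  congr 1
  simp only [← add_assoc, ξCoeff_add_single, signedCoeff_add_single, lt_irrefl, if_false, mul_one]
  by_cases h : i < j
  · have e₃ : (b + Pi.single j 1 : Fin θ → ℕ) i = b i := by simp [h.ne]
    have e₄ : (b + Pi.single j 1 + Pi.single i 1 : Fin θ → ℕ) i = b i + 1 := by simp [h.ne]
    simp only [h, if_true, e₃, e₄]
    have h3 := D.σ_add_σ_succ i (b i + 1)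
    rw [← h3]
    ring
  · simp [h]
    ring

/-- The chain map that lifts `η_i`. -/
def liftη (i : Fin θ) (m : ℕ) : D.K (1 + m) →ₗ[D.S] D.K m :=
  Finsupp.linearCombination D.S fun a => if a.1 i = 0 then 0 else
    (D.ηCoeff i a.1 • D.x i ^ (D.σ i (a.1 i) - 1)) • D.Φ m (a.1 - Pi.single i 1)

/-- The chain map that lifts `ξ_i`. -/
def liftξ (i : Fin θ) (m : ℕ) : D.K (2 + m) →ₗ[D.S] D.K m :=
  Finsupp.linearCombination D.S fun a => if a.1 i < 2 then 0 else
    D.ξCoeff i a.1 • D.Φ m (a.1 - Pi.single i 2)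

theorem liftη_Φ_of_eq_zero {i : Fin θ} (m : ℕ) {a : Fin θ → ℕ} (h : a i = 0) :
    D.liftη i m (D.Φ (1 + m) a) = 0 := by
  by_cases ha : ∑ l, a l = 1 + m
  · rw [D.Φ_coe ⟨a, ha⟩]
    simp [liftη, h]
  · rw [Φ_of_sum_ne D ha, map_zero]

theorem liftη_Φ_add (i : Fin θ) (m : ℕ) (a : Fin θ → ℕ) :
    D.liftη i m (D.Φ (1 + m) (a + Pi.single i 1)) =
      (D.ηCoeff i (a + Pi.single i 1) •
        D.x i ^ (D.σ i ((a + Pi.single i 1 : Fin θ → ℕ) i) - 1)) • D.Φ m a := by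
  have hs := sum_add_single a i 1
  by_cases ha : ∑ l, (a + Pi.single i 1 : Fin θ → ℕ) l = 1 + m
  · rw [D.Φ_coe ⟨_, ha⟩, liftη, Finsupp.linearCombination_single, one_smul, if_neg (by simp),
      add_tsub_cancel_right]
  · rw [Φ_of_sum_ne D ha, map_zero, Φ_of_sum_ne D (by omega), smul_zero]

theorem liftξ_Φ_of_lt {i : Fin θ} (m : ℕ) {a : Fin θ → ℕ} (h : a i < 2) :
    D.liftξ i m (D.Φ (2 + m) a) = 0 := by
  by_cases ha : ∑ l, a l = 2 + m
  · rw [D.Φ_coe ⟨a, ha⟩]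
    rw [liftξ, Finsupp.linearCombination_single, if_pos h, smul_zero]
  · rw [Φ_of_sum_ne D ha, map_zero]

theorem liftξ_Φ_add (i : Fin θ) (m : ℕ) (a : Fin θ → ℕ) :
    D.liftξ i m (D.Φ (2 + m) (a + Pi.single i 2)) =
      D.ξCoeff i (a + Pi.single i 2) • D.Φ m a := by
  have hs := sum_add_single a i 2
  by_cases ha : ∑ l, (a + Pi.single i 2 : Fin θ → ℕ) l = 2 + m
  · rw [D.Φ_coe ⟨_, ha⟩, liftξ, Finsupp.linearCombination_single, one_smul, if_neg (by simp),
      add_tsub_cancel_right]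
  · rw [Φ_of_sum_ne D ha, map_zero, Φ_of_sum_ne D (by omega), smul_zero]

theorem map_algebra_smul {n m : ℕ} (f : D.K n →ₗ[D.S] D.K m) (r : k) (y : D.K n) :
    f (r • y) = r • f y := by
  rw [← algebraMap_smul D.S r y, map_smul, algebraMap_smul]

theorem dK_comp_liftη (i : Fin θ) (m : ℕ) :
    D.dK m ∘ₗ D.liftη i (m + 1) = D.liftη i m ∘ₗ D.dK (1 + m) := by
  refine D.hom_ext_Φ fun a _ => ?_
  have hd := D.dK_Φ (1 + m) a
  rw [LinearMap.comp_apply, LinearMap.comp_apply]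
  refine Eq.trans ?_ (congrArg (D.liftη i m) hd).symm
  rw [map_sum]
  by_cases ha : a i = 0
  · rw [liftη_Φ_of_eq_zero D _ ha, map_zero]
    refine (Finset.sum_eq_zero fun j _ => ?_).symm
    split_ifs
    · exact map_zero _
    · rw [map_smul, liftη_Φ_of_eq_zero D m (by simp [ha]), smul_zero]
  · obtain ⟨b, rfl⟩ : ∃ b, a = b + Pi.single i 1 :=
      ⟨a - Pi.single i 1, (sub_add_single (by omega)).symm⟩
    rw [liftη_Φ_add, map_smul, dK_Φ, Finset.smul_sum]
    refine Finset.sum_congr rfl fun j _ => ?_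
    by_cases hj : b j = 0
    · rw [if_pos hj, smul_zero]
      obtain rfl | hij := eq_or_ne j i
      · rw [if_neg ha, map_smul, add_tsub_cancel_right, liftη_Φ_of_eq_zero D m hj, smul_zero]
      · rw [if_pos (by simp [hj, hij]), map_zero]
    · obtain ⟨c, rfl⟩ : ∃ c, b = c + Pi.single j 1 :=
        ⟨b - Pi.single j 1, (sub_add_single (by omega)).symm⟩
      have e : c + Pi.single j 1 + Pi.single i 1 - Pi.single j 1 = c + Pi.single i 1 := by
        rw [add_right_comm, add_tsub_cancel_right]
      rw [if_neg hj, if_neg (by simp), map_smul, e, liftη_Φ_add, add_tsub_cancel_right, smul_smul,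
        smul_smul, smul_mul_smul_comm, smul_mul_smul_comm, ηCoeff_comm]

theorem dK_comp_liftξ (i : Fin θ) (m : ℕ) :
    D.dK m ∘ₗ D.liftξ i (m + 1) = D.liftξ i m ∘ₗ D.dK (2 + m) := by
  refine D.hom_ext_Φ fun a _ => ?_
  have hd := D.dK_Φ (2 + m) a
  rw [LinearMap.comp_apply, LinearMap.comp_apply]
  refine Eq.trans ?_ (congrArg (D.liftξ i m) hd).symm
  rw [map_sum]
  by_cases ha : a i < 2
  · rw [liftξ_Φ_of_lt D _ ha, map_zero]
    refine (Finset.sum_eq_zero fun j _ => ?_).symm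
    split_ifs
    · exact map_zero _
    · rw [map_smul, liftξ_Φ_of_lt D m (lt_of_le_of_lt (Nat.sub_le _ _) ha), smul_zero]
  · obtain ⟨b, rfl⟩ : ∃ b, a = b + Pi.single i 2 :=
      ⟨a - Pi.single i 2, (sub_add_single (by omega)).symm⟩
    rw [liftξ_Φ_add, map_algebra_smul, dK_Φ, Finset.smul_sum]
    refine Finset.sum_congr rfl fun j _ => ?_
    by_cases hj : b j = 0
    · rw [if_pos hj, smul_zero]
      obtain rfl | hij := eq_or_ne j i
      · rw [if_neg (by simp), map_smul, liftξ_Φ_of_lt D m (by simp [hj]), smul_zero]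
      · rw [if_pos (by simp [hj, hij]), map_zero]
    · obtain ⟨c, rfl⟩ : ∃ c, b = c + Pi.single j 1 :=
        ⟨b - Pi.single j 1, (sub_add_single (by omega)).symm⟩
      have e : c + Pi.single j 1 + Pi.single i 2 - Pi.single j 1 = c + Pi.single i 2 := by
        rw [add_right_comm, add_tsub_cancel_right]
      rw [if_neg hj, if_neg (by simp), map_smul, e, liftξ_Φ_add, add_tsub_cancel_right,
        ← smul_assoc, smul_smul, ξCoeff_comm, smul_comm, ← smul_assoc, smul_smul, mul_comm]

end QCIData

/-! ### The basis of the cohomology dual to the generators of `K` -/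

theorem DFinsupp.basis_apply {ι R : Type*} {M : ι → Type*} [Semiring R]
    [∀ i, AddCommMonoid (M i)] [∀ i, Module R (M i)] [DecidableEq ι] {η : ι → Type*}
    (b : ∀ i, Module.Basis (η i) R (M i)) (i : ι) (x : η i) :
    DFinsupp.basis b ⟨i, x⟩ = DFinsupp.single i (b i x) := by
  refine Module.Basis.apply_eq_iff.2 (Finsupp.ext ?_)
  rintro ⟨j, y⟩
  change (b j).repr (DFinsupp.single i (b i x) j) y = _
  by_cases h : i = j
  · subst h
    simp [Finsupp.single_apply_left sigma_mk_injective]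
  · rw [DFinsupp.single_eq_of_ne (Ne.symm h), map_zero, Finsupp.single_eq_of_ne]
    · rfl
    · rintro ⟨⟩
      exact h rfl

namespace QCIData

variable {k : Type u} [Field k] {θ : ℕ} (D : QCIData k θ)

/-- Minimality of `K`: the exponents `σ_i` are positive, so the coefficients of `d` lie in the
augmentation ideal. -/
theorem comp_dK_eq_zero {n : ℕ} (u : D.K n →ₗ[D.S] D.Triv) : u ∘ₗ D.dK n = 0 := by
  refine D.hom_ext_Φ fun a _ => ?_
  rw [LinearMap.comp_apply, dK_Φ, map_sum, LinearMap.zero_apply]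
  refine Finset.sum_eq_zero fun i _ => ?_
  split_ifs
  · exact map_zero _
  · rw [map_smul, smul_triv]
    have h : D.ε (D.dCoeff i a • D.x i ^ D.σ i (a i)) = 0 := by simp [ε_x, σ_pos]
    rw [h]
    exact zero_mul (M₀ := k) _

/-- The linear function on `K_n` with prescribed values on the generators. -/
def ofCoords {n : ℕ} (w : {a : Fin θ → ℕ // ∑ i, a i = n} → k) : D.K n →ₗ[D.S] D.Triv :=
  Finsupp.linearCombination D.S fun a => (show D.Triv from w a)

theorem ofCoords_Φ {n : ℕ} (w : {a : Fin θ → ℕ // ∑ i, a i = n} → k)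
    (a : {a : Fin θ → ℕ // ∑ i, a i = n}) : D.ofCoords w (D.Φ n a.1) = w a := by
  rw [Φ_coe, ofCoords, Finsupp.linearCombination_single, one_smul]

theorem ofCoords_surjective {n : ℕ} (u : D.K n →ₗ[D.S] D.Triv) : ∃ w, D.ofCoords w = u :=
  ⟨fun a => u (D.Φ n a.1), D.hom_ext_Φ fun a ha => D.ofCoords_Φ _ ⟨a, ha⟩⟩

theorem ofCoords_add {n : ℕ} (v w : {a : Fin θ → ℕ // ∑ i, a i = n} → k) :
    D.ofCoords (v + w) = D.ofCoords v + D.ofCoords w := by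
  refine D.hom_ext_Φ fun a ha => ?_
  rw [LinearMap.add_apply, D.ofCoords_Φ _ ⟨a, ha⟩, D.ofCoords_Φ _ ⟨a, ha⟩, D.ofCoords_Φ _ ⟨a, ha⟩]
  rfl

theorem ofCoords_smul {n : ℕ} (r : k) (w : {a : Fin θ → ℕ // ∑ i, a i = n} → k) (y : D.K n) :
    D.ofCoords (r • w) y = algebraMap k D.S r • D.ofCoords w y := by
  induction y using Finsupp.induction_linear with
  | zero => simp
  | add y z hy hz => rw [map_add, map_add, smul_add, hy, hz]
  | single a s =>
    rw [ofCoords, ofCoords, Finsupp.linearCombination_single, Finsupp.linearCombination_single,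
      smul_triv, smul_triv, smul_triv, AlgHom.commutes]
    exact mul_left_comm (D.ε s) r (w a)

theorem dual_eq_ofCoords (n : ℕ) (b : Fin θ → ℕ) :
    D.dual n b = D.ofCoords fun a => if a.1 = b then 1 else 0 := rfl

theorem ofHom_comp {n m l : ℕ} (f : D.K n →ₗ[D.S] D.K m) (g : D.K m →ₗ[D.S] D.K l) :
    (ModuleCat.ofHom (g ∘ₗ f) : ModuleCat.of D.S (D.K n) ⟶ ModuleCat.of D.S (D.K l)) =
      (ModuleCat.ofHom f : ModuleCat.of D.S (D.K n) ⟶ ModuleCat.of D.S (D.K m)) ≫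
        ModuleCat.ofHom g := rfl

theorem ofHom_comp_triv {n m : ℕ} (f : D.K n →ₗ[D.S] D.K m) (g : D.K m →ₗ[D.S] D.Triv) :
    (ModuleCat.ofHom (g ∘ₗ f) : ModuleCat.of D.S (D.K n) ⟶ D.triv) =
      (ModuleCat.ofHom f : ModuleCat.of D.S (D.K n) ⟶ ModuleCat.of D.S (D.K m)) ≫
        ModuleCat.ofHom g := rfl

namespace Resolution

variable {D} (P : D.Resolution)

theorem d_comp_eq_zero {n : ℕ} (u : D.K n →ₗ[D.S] D.Triv) :
    P.res.complex.d (n + 1) n ≫ (P.iso n).hom ≫ ModuleCat.ofHom u = 0 := by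
  rw [← Category.assoc, P.d_iso, Category.assoc, ← ModuleCat.ofHom_comp, comp_dK_eq_zero]
  simp

/-- The cohomology class of a linear function on `K_n`. -/
def cls {n : ℕ} (u : D.K n →ₗ[D.S] D.Triv) : Ext D.triv D.triv n :=
  P.res.extMk ((P.iso n).hom ≫ ModuleCat.ofHom u) (n + 1) rfl (P.d_comp_eq_zero u)

theorem dualClass_eq (n : ℕ) (b : Fin θ → ℕ) : P.dualClass n b = P.cls (D.dual n b) := rfl

theorem cls_add {n : ℕ} (u v : D.K n →ₗ[D.S] D.Triv) : P.cls (u + v) = P.cls u + P.cls v := by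
  simp only [cls]
  rw [ProjectiveResolution.add_extMk]
  congr 1

theorem cls_ofCoords_smul {n : ℕ} (r : k) (w : {a : Fin θ → ℕ // ∑ i, a i = n} → k) :
    P.cls (D.ofCoords (r • w)) = r • P.cls (D.ofCoords w) := by
  have h : r • ((P.iso n).hom ≫ ModuleCat.ofHom (D.ofCoords w)) =
      (P.iso n).hom ≫ ModuleCat.ofHom (D.ofCoords (r • w)) := by
    rw [← Linear.comp_smul]
    congr 1
    ext y
    exact (D.ofCoords_smul r w _).symm
  simp only [cls]
  rw [← ProjectiveResolution.smul_extMk _ r _ _ (by rw [h]; exact P.d_comp_eq_zero _)]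
  congr 1
  exact h.symm

theorem cls_surjective {n : ℕ} (x : Ext D.triv D.triv n) : ∃ u, P.cls u = x := by
  obtain ⟨f, hf, rfl⟩ := P.res.extMk_surjective x (n + 1) rfl
  refine ⟨((P.iso n).inv ≫ f).hom, ?_⟩
  simp [cls]

/-- A null class is a coboundary, and by minimality every coboundary is zero. Degree `0` has no
preceding term of the resolution and is treated separately. -/
theorem cls_eq_zero {n : ℕ} {u : D.K n →ₗ[D.S] D.Triv} (h : P.cls u = 0) : u = 0 := by
  suffices (P.iso n).hom ≫ ModuleCat.ofHom u = 0 by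
    rw [← Limits.comp_zero (f := (P.iso n).hom), cancel_epi] at this
    exact congrArg ModuleCat.Hom.hom this
  cases n with
  | zero => exact P.res.extMk_zero_injective _ _ h
  | succ n =>
    obtain ⟨g, hg⟩ := (P.res.extMk_eq_zero_iff _ _ rfl _ n rfl).1 h
    have h0 := P.d_comp_eq_zero ((P.iso n).inv ≫ g).hom
    rw [ModuleCat.ofHom_hom, Iso.hom_inv_id_assoc] at h0
    rw [← hg, h0]

/-- Cohomology classes of degree `n` in terms of their values on the generators of `K_n`. -/
def clsEquiv (n : ℕ) : ({a : Fin θ → ℕ // ∑ i, a i = n} → k) ≃ₗ[k] Ext D.triv D.triv n :=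
  LinearEquiv.ofBijective
    { toFun := fun w => P.cls (D.ofCoords w)
      map_add' := fun v w => by rw [ofCoords_add, cls_add]
      map_smul' := fun r w => P.cls_ofCoords_smul r w } <| by
    constructor
    · refine (injective_iff_map_eq_zero _).2 fun w hw => ?_
      have h0 := P.cls_eq_zero hw
      funext a
      rw [← D.ofCoords_Φ w a, h0]
      rfl
    · intro x
      obtain ⟨u, rfl⟩ := P.cls_surjective x
      obtain ⟨w, rfl⟩ := D.ofCoords_surjective u
      exact ⟨w, rfl⟩

instance (n : ℕ) : Finite {a : Fin θ → ℕ // ∑ i, a i = n} :=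
  ((Set.finite_Iic (fun _ : Fin θ => n)).subset fun a (ha : ∑ i, a i = n) i => by
    rw [← ha]; exact Finset.single_le_sum (fun _ _ => Nat.zero_le _) (Finset.mem_univ i)).to_subtype

/-- The basis of the cohomology in degree `n` dual to the generators of `K_n`. -/
def extBasis (n : ℕ) :
    Module.Basis {a : Fin θ → ℕ // ∑ i, a i = n} k (Ext D.triv D.triv n) :=
  (Pi.basisFun k _).map (P.clsEquiv n)

theorem extBasis_apply (n : ℕ) (a : {a : Fin θ → ℕ // ∑ i, a i = n}) :
    P.extBasis n a = P.dualClass n a.1 := by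
  classical
  rw [extBasis, Module.Basis.map_apply, Pi.basisFun_apply, dualClass_eq, dual_eq_ofCoords]
  change P.cls (D.ofCoords _) = _
  congr 2
  funext b
  simp [Pi.single_apply, Subtype.ext_iff]

/-- The class in `H^*(S, k)` of the function dual to `Φ(a)`. -/
def gen (a : Fin θ → ℕ) : D.H :=
  DirectSum.of (fun n : ℕ => Ext D.triv D.triv n) (∑ i, a i) (P.dualClass _ a)

theorem gen_eq {n : ℕ} {a : Fin θ → ℕ} (h : ∑ i, a i = n) :
    P.gen a = DirectSum.of (fun n : ℕ => Ext D.triv D.triv n) n (P.dualClass n a) := by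
  subst h; rfl

/-- The basis of the cohomology algebra dual to the generators of `K`. -/
def genBasis : Module.Basis (Fin θ → ℕ) k D.H :=
  Module.Basis.reindex (show Module.Basis (Σ n, {a : Fin θ → ℕ // ∑ i, a i = n}) k D.H from
    DFinsupp.basis P.extBasis) (Equiv.sigmaFiberEquiv fun a : Fin θ → ℕ => ∑ i, a i)

theorem genBasis_apply (a : Fin θ → ℕ) : P.genBasis a = P.gen a := by
  rw [genBasis, Module.Basis.reindex_apply]
  refine (DFinsupp.basis_apply P.extBasis _ _).trans ?_
  rw [extBasis_apply]
  rfl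

/-- Transport of `yonedaMul_extMk` along the isomorphisms with `K`: a chain map `L` lifts the
cocycle `augK ∘ L 0`. -/
theorem yonedaMul_cls {n m : ℕ} (L : ∀ m, D.K (n + m) →ₗ[D.S] D.K m)
    (hL : ∀ m, D.dK m ∘ₗ L (m + 1) = L m ∘ₗ D.dK (n + m)) (v : D.K m →ₗ[D.S] D.Triv) :
    YonedaAlgebra.yonedaMul (P.cls v) (P.cls (n := n) (D.augK ∘ₗ L 0)) (add_comm m n) =
      P.cls (v ∘ₗ L m) := by
  refine (YonedaAlgebra.yonedaMul_extMk P.res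
    (fun m => (P.iso (n + m)).hom ≫ ModuleCat.ofHom (L m) ≫ (P.iso m).inv) ?_ _ _ ?_ _ _ ?_).trans ?_
  · intro m
    have h : (P.iso (m + 1)).inv ≫ P.res.complex.d (m + 1) m =
        ModuleCat.ofHom (D.dK m) ≫ (P.iso m).inv := by
      rw [Iso.inv_comp_eq, ← Category.assoc, ← P.d_iso, Category.assoc, Iso.hom_inv_id,
        Category.comp_id]
    have h' : P.res.complex.d (n + m + 1) (n + m) ≫ (P.iso (n + m)).hom = _ := P.d_iso (n + m)
    rw [Category.assoc, Category.assoc, h, ← Category.assoc (ModuleCat.ofHom _),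
      ← ModuleCat.ofHom_comp, hL, D.ofHom_comp, Category.assoc,
      ← Category.assoc (P.res.complex.d _ _), h', Category.assoc]
    rfl
  · rw [P.π_iso, D.ofHom_comp_triv]
    simp only [Category.assoc, Iso.inv_hom_id, Iso.inv_hom_id_assoc, Category.comp_id]
    rfl
  · have h := P.d_comp_eq_zero (v ∘ₗ L m)
    rw [D.ofHom_comp_triv] at h
    simpa only [Category.assoc, Iso.inv_hom_id_assoc] using h
  · simp only [cls, D.ofHom_comp_triv, Category.assoc, Iso.inv_hom_id_assoc]

end Resolution

/-! ### Products of the dual classes -/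

theorem dual_smul_Φ {n : ℕ} {a : Fin θ → ℕ} (ha : ∑ i, a i = n) (b : Fin θ → ℕ) (s : D.S) :
    D.dual n b (s • D.Φ n a) = (if a = b then D.ε s else 0 : k) := by
  rw [D.Φ_coe ⟨a, ha⟩, Finsupp.smul_single, smul_eq_mul, mul_one, dual_single]

theorem sum_eq_of_add_single {n m : ℕ} {a : Fin θ → ℕ} {i : Fin θ}
    (ha : ∑ l, (a + Pi.single i n : Fin θ → ℕ) l = n + m) : ∑ l, a l = m := by
  have := sum_add_single a i n
  omega

/-- The augmentation kills `x_i^{σ_i(b_i+1)-1}` unless its exponent is `0`, whence the inner case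
distinction. -/
theorem dual_liftη_Φ (i : Fin θ) {m : ℕ} (b : Fin θ → ℕ) {a : Fin θ → ℕ}
    (ha : ∑ l, a l = 1 + m) : D.dual m b (D.liftη i m (D.Φ (1 + m) a)) =
      (if a = b + Pi.single i 1 then
        if D.σ i (b i + 1) = 1 then D.ηCoeff i (b + Pi.single i 1) else 0 else 0 : k) := by
  by_cases h : a i = 0
  · rw [liftη_Φ_of_eq_zero D m h, map_zero]
    exact (if_neg (by rintro rfl; simp at h)).symm
  · obtain ⟨c, rfl⟩ : ∃ c, a = c + Pi.single i 1 :=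
      ⟨a - Pi.single i 1, (sub_add_single (by omega)).symm⟩
    rw [liftη_Φ_add]
    refine (dual_smul_Φ D (sum_eq_of_add_single ha) _ _).trans ?_
    refine (?_ : @Eq k _ _)
    by_cases hc : c = b
    · subst hc
      have := D.σ_pos i (c i + 1)
      by_cases hσ : D.σ i (c i + 1) = 1
      · simp [hσ]
      · simp [hσ, ε_x, show D.σ i (c i + 1) - 1 ≠ 0 by omega]
    · simp only [add_left_inj, hc, if_false]

theorem dual_liftξ_Φ (i : Fin θ) {m : ℕ} (b : Fin θ → ℕ) {a : Fin θ → ℕ}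
    (ha : ∑ l, a l = 2 + m) : D.dual m b (D.liftξ i m (D.Φ (2 + m) a)) =
      (if a = b + Pi.single i 2 then D.ξCoeff i (b + Pi.single i 2) else 0 : k) := by
  by_cases h : a i < 2
  · rw [liftξ_Φ_of_lt D m h, map_zero]
    exact (if_neg (by rintro rfl; simp at h)).symm
  · obtain ⟨c, rfl⟩ : ∃ c, a = c + Pi.single i 2 :=
      ⟨a - Pi.single i 2, (sub_add_single (by omega)).symm⟩
    rw [liftξ_Φ_add, ← algebraMap_smul D.S]
    refine (dual_smul_Φ D (sum_eq_of_add_single ha) _ _).trans ?_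
    refine (?_ : @Eq k _ _)
    by_cases hc : c = b
    · subst hc
      simp
    · simp only [add_left_inj, hc, if_false]

theorem upperCoeff_zero (i : Fin θ) : D.upperCoeff i 0 = 1 := by simp [upperCoeff, τ_zero]

theorem ξCoeff_zero (i : Fin θ) : D.ξCoeff i 0 = 1 := by simp [ξCoeff, τ_zero]

theorem lowerCoeff_zero_left (i : Fin θ) (a : Fin θ → ℕ) : D.lowerCoeff i 0 a = 1 := by
  simp [lowerCoeff]

theorem upperCoeff_single (i j : Fin θ) :
    D.upperCoeff i (Pi.single j 1) = if i < j then -(D.q i j : k) else 1 := by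
  rw [← zero_add (Pi.single j 1), upperCoeff_add_single, upperCoeff_zero]
  simp [σ_one]

theorem pi_single_two (i : Fin θ) :
    (Pi.single i 2 : Fin θ → ℕ) = Pi.single i 1 + Pi.single i 1 := by
  rw [← Pi.single_add]

theorem upperCoeff_single_two (i j : Fin θ) :
    D.upperCoeff i (Pi.single j 2) = if i < j then (D.q i j : k) ^ D.N j else 1 := by
  rw [pi_single_two, upperCoeff_add_single, upperCoeff_single, Pi.single_eq_same]
  split_ifs
  · rw [← D.σ_add_σ_succ j 1, σ_one, pow_add]
    ring
  · simp

theorem ξCoeff_single (i j : Fin θ) :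
    D.ξCoeff i (Pi.single j 1) = if i < j then (D.q i j : k) ^ D.N i else 1 := by
  rw [← zero_add (Pi.single j 1), ξCoeff_add_single, ξCoeff_zero]
  simp [σ_one]

theorem ξCoeff_single_two (i j : Fin θ) :
    D.ξCoeff i (Pi.single j 2) = if i < j then (D.q i j : k) ^ (D.N i * D.N j) else 1 := by
  rw [pi_single_two, ξCoeff_add_single, ξCoeff_single, Pi.single_eq_same]
  split_ifs
  · rw [← D.σ_add_σ_succ j 1, σ_one]
    ring
  · simp

theorem ξCoeff_add_single_two (i : Fin θ) (a : Fin θ → ℕ) :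
    D.ξCoeff i (a + Pi.single i 2) = D.ξCoeff i a := by
  rw [pi_single_two, ← add_assoc, ξCoeff_add_single, ξCoeff_add_single]
  simp

theorem ξCoeff_ne_zero (i : Fin θ) (a : Fin θ → ℕ) : D.ξCoeff i a ≠ 0 :=
  Finset.prod_ne_zero_iff.2 fun _ _ => pow_ne_zero _ (Units.ne_zero _)

theorem upperCoeff_ne_zero (i : Fin θ) (a : Fin θ → ℕ) : D.upperCoeff i a ≠ 0 :=
  Finset.prod_ne_zero_iff.2 fun _ _ => mul_ne_zero (pow_ne_zero _ (by simp))
    (pow_ne_zero _ (Units.ne_zero _))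

theorem ηCoeff_add_single_self {i : Fin θ} {a : Fin θ → ℕ} (h : D.σ i (a i + 1) = 1) :
    D.ηCoeff i (a + Pi.single i 1) = D.upperCoeff i a := by
  rw [ηCoeff, Pi.add_apply, Pi.single_eq_same, h, lowerCoeff_zero_left, upperCoeff_add_single]
  simp

/-- The identity of `K`, as a chain map that lowers degrees by `0`. -/
def liftOne (m : ℕ) : D.K (0 + m) →ₗ[D.S] D.K m :=
  Finsupp.linearCombination D.S fun a => D.Φ m a.1

theorem liftOne_Φ (m : ℕ) (a : Fin θ → ℕ) : D.liftOne m (D.Φ (0 + m) a) = D.Φ m a := by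
  by_cases ha : ∑ l, a l = 0 + m
  · rw [D.Φ_coe ⟨_, ha⟩, liftOne, Finsupp.linearCombination_single, one_smul]
  · rw [Φ_of_sum_ne D ha, map_zero, Φ_of_sum_ne D (by omega)]

theorem dK_comp_liftOne (m : ℕ) :
    D.dK m ∘ₗ D.liftOne (m + 1) = D.liftOne m ∘ₗ D.dK (0 + m) := by
  refine D.hom_ext_Φ fun a _ => ?_
  rw [LinearMap.comp_apply, LinearMap.comp_apply]
  refine Eq.trans ?_ (congrArg (D.liftOne m) (D.dK_Φ (0 + m) a)).symm
  rw [map_sum, liftOne_Φ, dK_Φ]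
  refine Finset.sum_congr rfl fun i _ => ?_
  split_ifs
  · exact (map_zero _).symm
  · rw [map_smul, liftOne_Φ]

namespace Resolution

variable {D} (P : D.Resolution)

theorem gen_mul_gen {n : ℕ} (L : ∀ m, D.K (n + m) →ₗ[D.S] D.K m)
    (hL : ∀ m, D.dK m ∘ₗ L (m + 1) = L m ∘ₗ D.dK (n + m)) {b c d : Fin θ → ℕ} (r : k)
    (hc : ∑ l, c l = n) (h₀ : D.augK ∘ₗ L 0 = D.dual n c) (hd : ∑ l, d l = n + ∑ l, b l)
    (h : ∀ a, ∑ l, a l = n + ∑ l, b l → D.dual (∑ l, b l) b (L _ (D.Φ _ a)) =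
      (if a = d then r else 0 : k)) :
    P.gen b * P.gen c = r • P.gen d := by
  rw [P.gen_eq hc, P.gen_eq hd, gen, DirectSum.of_mul_of, dualClass_eq, dualClass_eq, ← h₀]
  refine (DirectSum.of_eq_of_gradedMonoid_eq (YonedaAlgebra.mk_yonedaMul _ _ rfl
    (add_comm _ _))).trans ?_
  rw [P.yonedaMul_cls L hL, ← DirectSum.of_smul]
  congr 1
  rw [dualClass_eq, dual_eq_ofCoords (n := n + _), ← cls_ofCoords_smul]
  congr 1
  refine D.hom_ext_Φ fun a ha => ?_
  refine (h a ha).trans ?_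
  rw [D.ofCoords_Φ _ ⟨a, ha⟩]
  exact (by simp : (if a = d then r else 0) = r * (if a = d then 1 else 0))

theorem η_eq (i : Fin θ) : P.η i = P.gen (Pi.single i 1) :=
  (P.gen_eq (by simp)).symm

theorem ξ_eq (i : Fin θ) : P.ξ i = P.gen (Pi.single i 2) :=
  (P.gen_eq (by simp)).symm

theorem gen_mul_η (b : Fin θ → ℕ) (i : Fin θ) : P.gen b * P.η i =
    (if D.σ i (b i + 1) = 1 then D.upperCoeff i b else 0) • P.gen (b + Pi.single i 1) := by
  rw [η_eq]
  refine P.gen_mul_gen (D.liftη i) (D.dK_comp_liftη i) _ (by simp) ?_ ?_ ?_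
  · refine D.hom_ext_Φ fun a ha => ?_
    refine (D.dual_liftη_Φ i 0 ha).trans ?_
    rw [dual_eq_ofCoords, D.ofCoords_Φ _ ⟨a, ha⟩]
    refine (?_ : @Eq k _ _)
    have hσ : D.σ i ((0 : Fin θ → ℕ) i + 1) = 1 := D.σ_one i
    rw [if_pos hσ, ηCoeff_add_single_self D hσ, upperCoeff_zero, zero_add]
  · rw [sum_add_single, add_comm]
  · intro a ha
    refine (D.dual_liftη_Φ i b ha).trans (?_ : @Eq k _ _)
    split_ifs with h1 h2
    · rw [ηCoeff_add_single_self D h2]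
    · rfl
    · rfl

theorem gen_mul_ξ (b : Fin θ → ℕ) (i : Fin θ) :
    P.gen b * P.ξ i = D.ξCoeff i b • P.gen (b + Pi.single i 2) := by
  rw [ξ_eq]
  refine P.gen_mul_gen (D.liftξ i) (D.dK_comp_liftξ i) _ (by simp) ?_ ?_ ?_
  · refine D.hom_ext_Φ fun a ha => ?_
    refine (D.dual_liftξ_Φ i 0 ha).trans ?_
    rw [dual_eq_ofCoords, D.ofCoords_Φ _ ⟨a, ha⟩]
    refine (?_ : @Eq k _ _)
    rw [ξCoeff_add_single_two, ξCoeff_zero, zero_add]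
  · rw [sum_add_single, add_comm]
  · intro a ha
    refine (D.dual_liftξ_Φ i b ha).trans (?_ : @Eq k _ _)
    rw [ξCoeff_add_single_two]

/-- The identity chain map makes `gen 0` a right unit on a basis, hence on the whole algebra, and so
equal to `1`. -/
theorem gen_zero : P.gen 0 = 1 := by
  have h (b : Fin θ → ℕ) : P.gen b * P.gen 0 = P.gen b := by
    have := P.gen_mul_gen D.liftOne D.dK_comp_liftOne (b := b) (c := 0) (d := b) 1 (by simp)
      ?_ (by simp) ?_
    · rw [this, one_smul]
    · refine D.hom_ext_Φ fun a ha => ?_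
      rw [LinearMap.comp_apply, liftOne_Φ]
      rfl
    · intro a ha
      rw [liftOne_Φ, dual_eq_ofCoords, D.ofCoords_Φ _ ⟨a, by omega⟩]
  have h' : LinearMap.mulRight k (P.gen 0) = LinearMap.id :=
    P.genBasis.ext fun b => by rw [genBasis_apply, LinearMap.mulRight_apply, h]; rfl
  rw [← one_mul (P.gen 0)]
  exact LinearMap.congr_fun h' 1

theorem η_mul_η {i j : Fin θ} (h : i ≠ j) : P.η i * P.η j =
    (if j < i then -(D.q j i : k) else 1) • P.gen (Pi.single i 1 + Pi.single j 1) := by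
  rw [η_eq, gen_mul_η, upperCoeff_single, if_pos]
  simp [h.symm, σ_one]

/-- The scalar is nonzero only if `σ_i(2) = N_i - 1` equals `1`, that is, if `N_i = 2`. -/
theorem η_mul_self (i : Fin θ) : P.η i * P.η i = (if D.N i = 2 then 1 else 0 : k) • P.ξ i := by
  have h : D.σ i (1 + 1) = 1 ↔ D.N i = 2 := by
    have := D.one_lt_N i
    simp only [σ, if_neg (show ¬ Odd (1 + 1) by decide)]
    omega
  have := P.gen_mul_η (Pi.single i 1) i
  rw [← η_eq, upperCoeff_single, Pi.single_eq_same, ← pi_single_two, ← ξ_eq] at this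
  simpa [h] using this

theorem ξ_mul_η (i j : Fin θ) : P.ξ i * P.η j =
    (if j < i then (D.q j i : k) ^ D.N i else 1) • P.gen (Pi.single i 2 + Pi.single j 1) := by
  rw [ξ_eq, gen_mul_η, upperCoeff_single_two, if_pos]
  obtain rfl | h := eq_or_ne i j
  · simp [σ, Nat.odd_iff]
  · simp [h.symm, σ_one]

theorem η_mul_ξ (i j : Fin θ) : P.η i * P.ξ j =
    (if j < i then (D.q j i : k) ^ D.N j else 1) • P.gen (Pi.single i 1 + Pi.single j 2) := by
  rw [η_eq, gen_mul_ξ, ξCoeff_single]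

theorem ξ_mul_ξ (i j : Fin θ) : P.ξ i * P.ξ j =
    (if j < i then (D.q j i : k) ^ (D.N j * D.N i) else 1) •
      P.gen (Pi.single i 2 + Pi.single j 2) := by
  rw [ξ_eq, gen_mul_ξ, ξCoeff_single_two]

theorem ξ_mul_ξ_comm (i j : Fin θ) :
    P.ξ i * P.ξ j = (D.q j i : k) ^ (D.N i * D.N j) • (P.ξ j * P.ξ i) := by
  rw [ξ_mul_ξ, ξ_mul_ξ, smul_smul, add_comm (Pi.single i 2)]
  congr 1
  obtain h | rfl | h := lt_trichotomy i j
  · rw [if_neg h.not_gt, if_pos h, ← mul_pow, q_mul_q, one_pow]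
  · simp [D.q_self]
  · rw [if_pos h, if_neg h.not_gt, mul_one, mul_comm]

theorem η_mul_ξ_comm (i j : Fin θ) :
    P.η i * P.ξ j = (D.q j i : k) ^ D.N j • (P.ξ j * P.η i) := by
  rw [η_mul_ξ, ξ_mul_η, smul_smul, add_comm (Pi.single i 1)]
  congr 1
  obtain h | rfl | h := lt_trichotomy i j
  · rw [if_neg h.not_gt, if_pos h, ← mul_pow, q_mul_q, one_pow]
  · simp [D.q_self]
  · rw [if_pos h, if_neg h.not_gt, mul_one]

theorem η_mul_η_comm {i j : Fin θ} (h : i ≠ j) :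
    P.η i * P.η j = (-(D.q j i : k)) • (P.η j * P.η i) := by
  rw [η_mul_η _ h, η_mul_η _ h.symm, smul_smul, add_comm (Pi.single i 1)]
  congr 1
  obtain h | h := lt_or_gt_of_ne h
  · rw [if_neg h.not_gt, if_pos h, neg_mul_neg, q_mul_q]
  · rw [if_pos h, if_neg h.not_gt, mul_one]

theorem gen_mul_ξ_pow (b : Fin θ → ℕ) (i : Fin θ) (t : ℕ) :
    ∃ r : k, r ≠ 0 ∧ P.gen b * P.ξ i ^ t = r • P.gen (b + Pi.single i (2 * t)) := by
  induction t with
  | zero => exact ⟨1, one_ne_zero, by simp⟩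
  | succ t ih =>
    obtain ⟨r, hr, h⟩ := ih
    refine ⟨r * D.ξCoeff i (b + Pi.single i (2 * t)), mul_ne_zero hr (D.ξCoeff_ne_zero _ _), ?_⟩
    rw [pow_succ, ← mul_assoc, h, smul_mul_assoc, gen_mul_ξ, smul_smul, add_assoc, ← Pi.single_add]
    rfl

theorem gen_mul_prod_ξ (e : Fin θ → ℕ) (l : List (Fin θ)) (b : Fin θ → ℕ) :
    ∃ r : k, r ≠ 0 ∧ P.gen b * (l.map fun i => P.ξ i ^ e i).prod =
      r • P.gen (b + (l.map fun i => (Pi.single i (2 * e i) : Fin θ → ℕ)).sum) := by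
  induction l generalizing b with
  | nil => exact ⟨1, one_ne_zero, by simp⟩
  | cons i l ih =>
    obtain ⟨r, hr, h⟩ := P.gen_mul_ξ_pow b i (e i)
    obtain ⟨s, hs, h'⟩ := ih (b + Pi.single i (2 * e i))
    refine ⟨r * s, mul_ne_zero hr hs, ?_⟩
    rw [List.map_cons, List.prod_cons, ← mul_assoc, h, smul_mul_assoc, h', smul_smul, List.map_cons,
      List.sum_cons, add_assoc]

/-- An even exponent `b_i` gives `σ_i(b_i+1) = 1`, so multiplication by `η_i` is nonzero. Since `l`
has no repetition, each exponent is still even when its turn comes. -/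
theorem gen_mul_prod_η (c : Fin θ → Fin 2) (l : List (Fin θ)) (hl : l.Nodup) (b : Fin θ → ℕ)
    (hb : ∀ i ∈ l, Even (b i)) :
    ∃ r : k, r ≠ 0 ∧ P.gen b * (l.map fun i => P.η i ^ (c i : ℕ)).prod =
      r • P.gen (b + (l.map fun i => (Pi.single i (c i : ℕ) : Fin θ → ℕ)).sum) := by
  induction l generalizing b with
  | nil => exact ⟨1, one_ne_zero, by simp⟩
  | cons i l ih =>
    obtain ⟨r, hr, h⟩ : ∃ r : k, r ≠ 0 ∧
        P.gen b * P.η i ^ (c i : ℕ) = r • P.gen (b + Pi.single i (c i : ℕ)) := by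
      obtain h | h : (c i : ℕ) = 0 ∨ (c i : ℕ) = 1 := by omega
      · exact ⟨1, one_ne_zero, by simp [h]⟩
      · rw [h, pow_one, gen_mul_η, if_pos]
        · exact ⟨_, D.upperCoeff_ne_zero _ _, rfl⟩
        · rw [σ, if_pos (hb i (by simp)).add_one]
    obtain ⟨s, hs, h'⟩ := ih (List.nodup_cons.1 hl).2 (b + Pi.single i (c i : ℕ)) fun j hj => by
      have : j ≠ i := by rintro rfl; exact (List.nodup_cons.1 hl).1 hj
      simpa [this] using hb j (by simp [hj])
    refine ⟨r * s, mul_ne_zero hr hs, ?_⟩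
    rw [List.map_cons, List.prod_cons, ← mul_assoc, h, smul_mul_assoc, h', smul_smul, List.map_cons,
      List.sum_cons, add_assoc]

theorem sum_map_single_finRange (f : Fin θ → ℕ) :
    ((List.finRange θ).map fun i => (Pi.single i (f i) : Fin θ → ℕ)).sum = f := by
  rw [← List.ofFn_eq_map, List.sum_ofFn, Finset.univ_sum_single]

theorem exists_prod_eq_smul_gen (e : Fin θ → ℕ) (c : Fin θ → Fin 2) : ∃ r : kˣ,
    (List.ofFn fun i => P.ξ i ^ e i).prod * (List.ofFn fun i => P.η i ^ (c i : ℕ)).prod =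
      r • P.gen fun i => 2 * e i + (c i : ℕ) := by
  obtain ⟨r, hr, h⟩ := P.gen_mul_prod_ξ e (List.finRange θ) 0
  rw [gen_zero, one_mul, zero_add, sum_map_single_finRange fun i => 2 * e i] at h
  obtain ⟨s, hs, h'⟩ := P.gen_mul_prod_η c (List.finRange θ) (List.nodup_finRange θ)
    (fun i => 2 * e i) (by simp)
  rw [sum_map_single_finRange fun i => (c i : ℕ)] at h'
  refine ⟨Units.mk0 (r * s) (mul_ne_zero hr hs), ?_⟩
  rw [List.ofFn_eq_map, List.ofFn_eq_map, h, smul_mul_assoc, h', smul_smul]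
  rfl

end Resolution

/-- Division by `2` with remainder in each coordinate. -/
def divModEquiv (θ : ℕ) : (Fin θ → ℕ) × (Fin θ → Fin 2) ≃ (Fin θ → ℕ) where
  toFun p i := 2 * p.1 i + (p.2 i : ℕ)
  invFun a := (fun i => a i / 2, fun i => ⟨a i % 2, Nat.mod_lt _ two_pos⟩)
  left_inv p := by
    refine Prod.ext (funext fun i => ?_) (funext fun i => Fin.ext ?_) <;> dsimp only <;> omega
  right_inv a := funext fun i => Nat.div_add_mod _ _

namespace Resolution

variable {D} (P : D.Resolution)

/-- The basis of the cohomology algebra that consists of the ordered monomials in `ξ` and `η`. -/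
def monomialBasis : Module.Basis ((Fin θ → ℕ) × (Fin θ → Fin 2)) k D.H :=
  (P.genBasis.reindex (divModEquiv θ).symm).unitsSMul
    fun p => (P.exists_prod_eq_smul_gen p.1 p.2).choose

theorem monomialBasis_apply (e : Fin θ → ℕ) (c : Fin θ → Fin 2) : P.monomialBasis (e, c) =
    (List.ofFn fun i => P.ξ i ^ e i).prod * (List.ofFn fun i => P.η i ^ (c i : ℕ)).prod := by
  rw [monomialBasis, Module.Basis.unitsSMul_apply, Module.Basis.reindex_apply, genBasis_apply]
  exact (P.exists_prod_eq_smul_gen e c).choose_spec.symm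

end Resolution

/-! ### Spanning monomials in the presented algebra -/

/-- The generators of the presented algebra: `ξ_i` at `inl i` and `η_i` at `inr i`. -/
def cohGen (s : Fin θ ⊕ Fin θ) : RingQuot D.CohRel :=
  RingQuot.mkAlgHom k D.CohRel (FreeAlgebra.ι k s)

/-- The scalar by which `cohGen s * cohGen t` differs from `cohGen t * cohGen s`. -/
def cohScalar : Fin θ ⊕ Fin θ → Fin θ ⊕ Fin θ → k
  | .inl i, .inl j => (D.q j i : k) ^ (D.N i * D.N j)
  | .inl i, .inr j => (D.q j i : k) ^ D.N i
  | .inr i, .inl j => (D.q j i : k) ^ D.N j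
  | .inr i, .inr j => -(D.q j i : k)

theorem cohScalar_ne_zero (s t : Fin θ ⊕ Fin θ) : D.cohScalar s t ≠ 0 := by
  rcases s with i | i <;> rcases t with j | j <;> simp [cohScalar]

theorem cohGen_mul_cohGen {s t : Fin θ ⊕ Fin θ} (h : s ≠ t) :
    D.cohGen s * D.cohGen t = D.cohScalar s t • (D.cohGen t * D.cohGen s) := by
  have hηξ (i j : Fin θ) : D.cohGen (.inr i) * D.cohGen (.inl j) =
      D.cohScalar (.inr i) (.inl j) • (D.cohGen (.inl j) * D.cohGen (.inr i)) := by
    simpa [cohGen, cohScalar] using RingQuot.mkAlgHom_rel k (CohRel.ηξ (D := D) i j)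
  rcases s with i | i <;> rcases t with j | j
  · simpa [cohGen, cohScalar] using RingQuot.mkAlgHom_rel k (CohRel.ξξ (D := D) i j)
  -- This order of `ξ` and `η` is not among the relations; it follows from the opposite one by
  -- `q_{ij} q_{ji} = 1`.
  · rw [hηξ, smul_smul, cohScalar, cohScalar, ← mul_pow, q_mul_q, one_pow, one_smul]
  · exact hηξ i j
  · have := RingQuot.mkAlgHom_rel k (CohRel.ηη (D := D) i j (by rintro rfl; exact h rfl))
    rwa [map_mul, map_smul, map_mul] at this

theorem cohGen_inr_mul_self (i : Fin θ) : D.cohGen (.inr i) * D.cohGen (.inr i) =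
    (if D.N i = 2 then 1 else 0 : k) • D.cohGen (.inl i) := by
  split_ifs with h
  · simpa [cohGen] using RingQuot.mkAlgHom_rel k (CohRel.η_sq_two (D := D) i h)
  · simpa [cohGen] using RingQuot.mkAlgHom_rel k (CohRel.η_sq (D := D) i h)

/-- The order of the generators in a monomial: first the `ξ_i`, then the `η_i`. -/
def genList (θ : ℕ) : List (Fin θ ⊕ Fin θ) :=
  (List.finRange θ).map .inl ++ (List.finRange θ).map .inr

theorem nodup_genList : (genList θ).Nodup := by
  refine List.Nodup.append ((List.nodup_finRange θ).map Sum.inl_injective)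
    ((List.nodup_finRange θ).map Sum.inr_injective) ?_
  rintro a h h'
  obtain ⟨i, -, rfl⟩ := List.mem_map.1 h
  obtain ⟨j, -, h⟩ := List.mem_map.1 h'
  cases h

theorem mem_genList (s : Fin θ ⊕ Fin θ) : s ∈ genList θ := by
  rcases s with i | i <;> simp [genList]

/-- The ordered monomial in the presented algebra with given exponents. -/
def cohMono (f : Fin θ ⊕ Fin θ → ℕ) : RingQuot D.CohRel :=
  ((genList θ).map fun s => D.cohGen s ^ f s).prod

theorem cohMono_mul_cohGen (f : Fin θ ⊕ Fin θ → ℕ) (s : Fin θ ⊕ Fin θ) : ∃ r : k, r ≠ 0 ∧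
    D.cohMono f * D.cohGen s = r • D.cohMono (f + Pi.single s 1) := by
  obtain ⟨l₁, l₂, h⟩ := List.append_of_mem (mem_genList s)
  have hn : (l₁ ++ s :: l₂).Nodup := h ▸ nodup_genList
  obtain ⟨-, h₂, h₁⟩ := List.nodup_append.1 hn
  have h₂' := (List.nodup_cons.1 h₂).1
  refine ⟨(l₂.map fun t => D.cohScalar t s ^ f t).prod, ?_, ?_⟩
  · refine List.prod_ne_zero fun h0 => ?_
    obtain ⟨t, -, ht⟩ := List.mem_map.1 h0
    exact pow_ne_zero _ (D.cohScalar_ne_zero t s) ht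
  · rw [cohMono, cohMono, h]
    refine List.prod_map_pow_mul D.cohGen (fun t => D.cohScalar t s) f s l₁ l₂
      (fun hs => h₁ _ hs _ (by simp) rfl) h₂' fun t ht => D.cohGen_mul_cohGen ?_
    rintro rfl
    exact h₂' ht

/-- The span of the ordered monomials in which every `η_i` has exponent `0` or `1`. -/
def cohSpan : Submodule k (RingQuot D.CohRel) :=
  Submodule.span k (D.cohMono '' {f | ∀ i, f (.inr i) < 2})

theorem cohMono_mul_inl_mem {f : Fin θ ⊕ Fin θ → ℕ} (hf : ∀ i, f (.inr i) < 2) (j : Fin θ) :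
    D.cohMono f * D.cohGen (.inl j) ∈ D.cohSpan := by
  obtain ⟨r, -, h⟩ := D.cohMono_mul_cohGen f (.inl j)
  rw [h]
  exact Submodule.smul_mem _ _ (Submodule.subset_span ⟨_, fun i => by simpa using hf i, rfl⟩)

/-- If `η_j` already occurs, it can be moved to the right end at the cost of a nonzero scalar. It
then meets the new factor, and `η_j^2` is a multiple of `ξ_j`, which leads back to the previous
lemma. -/
theorem cohMono_mul_inr_mem {f : Fin θ ⊕ Fin θ → ℕ} (hf : ∀ i, f (.inr i) < 2) (j : Fin θ) :
    D.cohMono f * D.cohGen (.inr j) ∈ D.cohSpan := by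
  obtain h0 | h1 : f (.inr j) = 0 ∨ f (.inr j) = 1 := by have := hf j; omega
  · obtain ⟨r, -, h⟩ := D.cohMono_mul_cohGen f (.inr j)
    rw [h]
    refine Submodule.smul_mem _ _ (Submodule.subset_span ⟨_, fun i => ?_, rfl⟩)
    obtain rfl | hij := eq_or_ne i j
    · simp [h0]
    · simpa [hij] using hf i
  · obtain ⟨g, rfl⟩ : ∃ g : Fin θ ⊕ Fin θ → ℕ, f = g + (Pi.single (Sum.inr j) 1 : Fin θ ⊕ Fin θ → ℕ) := by
      refine ⟨f - Pi.single (.inr j) 1, funext fun s => ?_⟩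
      obtain rfl | hs := eq_or_ne s (.inr j)
      · simp [h1]
      · simp [hs]
    obtain ⟨r, hr, h⟩ := D.cohMono_mul_cohGen g (.inr j)
    rw [← inv_smul_eq_iff₀ hr] at h
    rw [← h, smul_mul_assoc, mul_assoc, cohGen_inr_mul_self, mul_smul_comm]
    refine Submodule.smul_mem _ _ (Submodule.smul_mem _ _ (D.cohMono_mul_inl_mem (fun i => ?_) j))
    exact lt_of_le_of_lt (by simp) (hf i)

theorem cohMono_zero : D.cohMono 0 = 1 := by
  simp [cohMono]

/-- The span contains `1` and is stable under right multiplication by generators, hence by all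
elements. -/
theorem cohSpan_eq_top : D.cohSpan = ⊤ := by
  have hmul (s : Fin θ ⊕ Fin θ) : D.cohSpan ≤
      D.cohSpan.comap (LinearMap.mulRight k (D.cohGen s)) := by
    refine Submodule.span_le.2 ?_
    rintro _ ⟨f, hf, rfl⟩
    rcases s with j | j
    · exact D.cohMono_mul_inl_mem hf j
    · exact D.cohMono_mul_inr_mem hf j
  have h1 : 1 ∈ D.cohSpan := Submodule.subset_span ⟨0, by simp, D.cohMono_zero⟩
  refine eq_top_iff.2 fun y _ => ?_
  obtain ⟨p, rfl⟩ := RingQuot.mkAlgHom_surjective k D.CohRel y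
  suffices h : ∀ v ∈ D.cohSpan, v * RingQuot.mkAlgHom k D.CohRel p ∈ D.cohSpan by
    simpa using h 1 h1
  clear * - hmul
  induction p with
  | grade0 r =>
    intro v hv
    rw [AlgHom.commutes, ← Algebra.commutes, ← Algebra.smul_def]
    exact Submodule.smul_mem _ _ hv
  | grade1 s => exact fun v hv => hmul s hv
  | mul p p' hp hp' =>
    intro v hv
    rw [map_mul, ← mul_assoc]
    exact hp' _ (hp _ hv)
  | add p p' hp hp' =>
    intro v hv
    rw [map_add, mul_add]
    exact add_mem (hp _ hv) (hp' _ hv)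

/-! ### Comparison of the presented algebra with the cohomology -/

namespace Resolution

variable {D} (P : D.Resolution)

/-- The map from the presented algebra to the cohomology algebra. -/
def ofPresentation : RingQuot D.CohRel →ₐ[k] D.H :=
  RingQuot.liftAlgHom k ⟨FreeAlgebra.lift k (Sum.elim P.ξ P.η), by
    intro a b h
    induction h with
    | ξξ i j => simpa using P.ξ_mul_ξ_comm i j
    | ηξ i j => simpa using P.η_mul_ξ_comm i j
    | ηη i j hij => simpa using P.η_mul_η_comm hij
    | η_sq i hi => simpa [hi] using P.η_mul_self i
    | η_sq_two i hi => simpa [hi] using P.η_mul_self i⟩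

theorem ofPresentation_cohGen (s : Fin θ ⊕ Fin θ) :
    P.ofPresentation (D.cohGen s) = Sum.elim P.ξ P.η s := by
  simp [ofPresentation, cohGen]

theorem ofPresentation_cohMono (e : Fin θ → ℕ) (c : Fin θ → Fin 2) :
    P.ofPresentation (D.cohMono (Sum.elim e fun i => c i)) = P.monomialBasis (e, c) := by
  rw [monomialBasis_apply, cohMono, map_list_prod, List.map_map, genList, List.map_append,
    List.prod_append, List.map_map, List.map_map, List.ofFn_eq_map, List.ofFn_eq_map]
  congr 2 <;> refine List.map_congr_left fun i _ => ?_ <;> simp [ofPresentation_cohGen]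

/-- A linear map defined on the monomial basis returns each monomial to the presented algebra. One
composite is the identity on a basis, the other on a spanning set. -/
theorem ofPresentation_bijective : Function.Bijective P.ofPresentation := by
  let g : D.H →ₗ[k] RingQuot D.CohRel :=
    P.monomialBasis.constr k fun p => D.cohMono (Sum.elim p.1 fun i => p.2 i)
  have hg (e c) : g (P.monomialBasis (e, c)) = D.cohMono (Sum.elim e fun i => c i) :=
    P.monomialBasis.constr_basis k _ _
  have h₁ : g ∘ₗ P.ofPresentation.toLinearMap = LinearMap.id := by
    refine LinearMap.ext_on (show Submodule.span k _ = ⊤ from D.cohSpan_eq_top) ?_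
    rintro _ ⟨f, hf, rfl⟩
    obtain ⟨e, c, rfl⟩ : ∃ (e : Fin θ → ℕ) (c : Fin θ → Fin 2), Sum.elim e (fun i => c i) = f :=
      ⟨fun i => f (.inl i), fun i => ⟨f (.inr i), hf i⟩, by ext (i | i) <;> rfl⟩
    rw [LinearMap.comp_apply, AlgHom.toLinearMap_apply, ofPresentation_cohMono, hg]
    rfl
  have h₂ : P.ofPresentation.toLinearMap ∘ₗ g = LinearMap.id := by
    refine P.monomialBasis.ext fun p => ?_
    rw [LinearMap.comp_apply, hg, AlgHom.toLinearMap_apply, ofPresentation_cohMono]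
    rfl
  exact ⟨Function.LeftInverse.injective (g := g) fun y => LinearMap.congr_fun h₁ y,
    Function.RightInverse.surjective (g := g) fun y => LinearMap.congr_fun h₂ y⟩

end Resolution

end QCIData

end

theorem mainTheorem7 {k : Type u} [Field k] {θ : ℕ} (D : QCIData k θ) :
    Nonempty D.Resolution ∧ ∀ P : D.Resolution,
      (∃ φ : RingQuot D.CohRel →ₐ[k] D.H, Function.Bijective φ ∧
        (∀ i, φ (RingQuot.mkAlgHom k D.CohRel (QCIData.Xi i)) = P.ξ i) ∧
        (∀ i, φ (RingQuot.mkAlgHom k D.CohRel (QCIData.Eta i)) = P.η i)) ∧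
      (∃ b : Module.Basis ((Fin θ → ℕ) × (Fin θ → Fin 2)) k D.H, ∀ e c,
        b (e, c) = (List.ofFn fun i => P.ξ i ^ e i).prod *
          (List.ofFn fun i => P.η i ^ (c i : ℕ)).prod) := by
  exact ⟨D.nonempty_resolution, fun P => ⟨⟨P.ofPresentation, P.ofPresentation_bijective,
    fun i => P.ofPresentation_cohGen (.inl i), fun i => P.ofPresentation_cohGen (.inr i)⟩,
    P.monomialBasis, P.monomialBasis_apply⟩⟩
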